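/- **Setting.** A directed graph (DG) on $[p]$ may contain cycles but no self-loops; $E(G)$ is its edge set. A parameter of $G$ is a pair $(B,\Omega)$ where $B\in\mathbb R^{p\times p}$ satisfies $B_{ij}\neq 0\Rightarrow (i\to j)\in E(G)$ and $\det(I-B)\ne 0$, and $\Omega=\mathrm{diag}(\sigma_1^2,\dots,\sigma_p^2)$ with all $\sigma_i^2>0$. It generates the centred Gaussian vector $X=B^\top X+N$, $N\sim\mathcal N(0,\Omega)$, whose precision matrix is $(I-B)\Omega^{-1}(I-B)^\top$. Let $\Theta(G)$ be the set of precision matrices generated by the parameters of $G$. DGs $G_1,G_2$ are equivalent, $G_1\equiv G_2$, if $\Theta(G_1)=\Theta(G_2)$; $G$ is irreducible if no DG $G'$ with $E(G')\subsetneq E(G)$ is equivalent to $G$. A constraint is an equation $\kappa=0$, with $\kappa$ a polynomial with rational coefficients in the entries $\Theta_{ij}$, $i\le j$, of a symmetric matrix. The set $H(G)$ of hard constraints of $G$ consists of the constraints that hold on all of $\Theta(G)$ and whose solution set is Lebesgue-null in the space of the entries; a hard constraint is an element of $H(G')$ for some DG $G'$ on $[p]$. A precision matrix $\Theta$ is g-faithful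 to $G$ if for every hard constraint $\kappa$: $\Theta$ satisfies $\kappa$ if and only if $\kappa\in H(G)$. $G_1$ and $G_2$ are quasi-equivalent, $G_1\cong G_2$, if $\Theta(G_1)\cap\Theta(G_2)$ has nonzero $d$-dimensional Hausdorff measure (Lebesgue surface measure), where $d$ is the (Hausdorff) dimension of $\Theta(G_1)\cup\Theta(G_2)$; symmetric matrices are identified with the vectors of their entries $(i,j)$, $i\le j$. For a data matrix $\mathbf X\in\mathbb R^{n\times p}$ let $$\mathcal L(\mathbf X:B,\Omega)=-n\log|\det(I-B)|+\sum_{i=1}^p\Big(\frac n2\log\sigma_i^2+\frac1{2\sigma_i^2}\|\mathbf X_{\cdot,i}-\mathbf XB_{\cdot,i}\|_2^2\Big),$$ let $\|B\|_0$ be the number of nonzero entries of $B$, and consider $$\min_G\ \min_{(B,\Omega)\text{ parameter of }G}\ \mathcal L(\mathbf X:B,\Omega)+\lambda\|B\|_0 .\qquad(\ast)$$ An output of $(\ast)$ is the graph $\hat G$ with edges $\{i\to j:\hat B_{ij}\ne0\}$, where $(\hat G_0,\hat B,\hat\Omega)$ is a global minimizer of $(\ast)$. **Theorem.** Let $G^*$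 be a DG on $[p]$ and $(B,\Omega)$ a parameter of $G^*$, with precision matrix $\Theta=(I-B)\Omega^{-1}(I-B)^\top$. Assume that 1. $\Theta$ is g-faithful to $G^*$; 2. there is an irreducible DG $G^\dagger\equiv G^*$ (one may take $G^\dagger=G^*$ if $G^*$ is irreducible) such that every DG $G$ with $H(G)\subseteq H(G^\dagger)$ and $|E(G)|\le|E(G^\dagger)|$ satisfies $H(G)=H(G^\dagger)$. Let $X^{(1)},X^{(2)},\dots$ be i.i.d. samples of the model, $X^{(k)}=B^\top X^{(k)}+N^{(k)}$ with $N^{(k)}\sim\mathcal N(0,\Omega)$ independent, and let $\mathbf X$ be the $n\times p$ matrix with rows $X^{(1)},\dots,X^{(n)}$. Then, with probability tending to $1$ as $n\to\infty$, the problem $(\ast)$ with $\lambda=0.5\log n$ has a global minimizer and every output $\hat G$ of $(\ast)$ satisfies $\hat G\cong G^*$. -/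

import Mathlib

open MeasureTheory ProbabilityTheory Filter Topology
open scoped BigOperators Matrix

/-- A directed graph (cycles and 2-cycles allowed, no self-loops) on the `p` variables. -/
structure DG (p : ℕ) extends Digraph (Fin p) where
  loopless : ∀ i, ¬ Adj i i

namespace DG

variable {p : ℕ}

/-- The edge set `E(G)`; `(i, j)` stands for the edge `X_i → X_j`. -/
def edgeSet (G : DG p) : Set (Fin p × Fin p) := {e | G.Adj e.1 e.2}

/-- The number of edges `|E(G)|`. -/
noncomputable def numEdges (G : DG p) : ℕ := G.edgeSet.ncard

/-- `(B, σ²)` is a choice of edge weights and noise variances for `G`: the support of `B` lies in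
`E(G)` (so `B` has zero diagonal), the variances are positive, and the model is nonsingular. -/
structure IsParam (G : DG p) (B : Matrix (Fin p) (Fin p) ℝ) (σ2 : Fin p → ℝ) : Prop where
  supp : ∀ i j, B i j ≠ 0 → G.Adj i j
  pos : ∀ i, 0 < σ2 i
  nonsing : (1 - B).det ≠ 0

end DG

/-- The precision matrix `(I - B) Ω⁻¹ (I - B)ᵀ`, where `Ω = diag(σ²)`. -/
noncomputable def precisionMatrix {p : ℕ} (B : Matrix (Fin p) (Fin p) ℝ) (σ2 : Fin p → ℝ) :
    Matrix (Fin p) (Fin p) ℝ :=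
  (1 - B) * Matrix.diagonal (fun i => (σ2 i)⁻¹) * (1 - B)ᵀ

/-- Positions `(i, j)` with `i ≤ j`: the free entries of a symmetric `p × p` matrix. -/
abbrev UpperIndex (p : ℕ) : Type := {e : Fin p × Fin p // e.1 ≤ e.2}

/-- The vector of free entries of a symmetric matrix. -/
def symEntries {p : ℕ} (T : Matrix (Fin p) (Fin p) ℝ) : UpperIndex p → ℝ :=
  fun e => T e.1.1 e.1.2

namespace DG

variable {p : ℕ}

/-- The distribution set `Θ(G)`: all precision matrices that `G` can generate. -/
def distSet (G : DG p) : Set (Matrix (Fin p) (Fin p) ℝ) :=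
  {T | ∃ B σ2, G.IsParam B σ2 ∧ T = precisionMatrix B σ2}

/-- Distribution equivalence. -/
def DistEquiv (G₁ G₂ : DG p) : Prop := G₁.distSet = G₂.distSet

/-- `G` is reducible if a graph with a strictly smaller edge set is equivalent to it. -/
def Reducible (G : DG p) : Prop := ∃ G' : DG p, G.DistEquiv G' ∧ G'.edgeSet ⊂ G.edgeSet

end DG

/-- The precision matrix `T` satisfies the equation `κ = 0` between its entries. -/
def Satisfies {p : ℕ} (T : Matrix (Fin p) (Fin p) ℝ) (κ : MvPolynomial (UpperIndex p) ℚ) : Prop :=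
  MvPolynomial.aeval (symEntries T) κ = 0

namespace DG

variable {p : ℕ}

/-- The equation `κ = 0` is a distributional constraint of `G`: it holds on all of `Θ(G)`. -/
def IsDistConstraint (G : DG p) (κ : MvPolynomial (UpperIndex p) ℚ) : Prop :=
  ∀ T ∈ G.distSet, Satisfies T κ

/-- The hard constraints `H(G)`: the distributional constraints of `G` whose set of solutions is
Lebesgue-null in the space of the entries. -/
def hardConstraints (G : DG p) : Set (MvPolynomial (UpperIndex p) ℚ) :=
  {κ | G.IsDistConstraint κ ∧
    volume {v : UpperIndex p → ℝ | MvPolynomial.aeval v κ = 0} = 0}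

end DG

/-- A hard constraint is a hard constraint of some directed graph on the `p` variables. -/
def IsHardConstraint {p : ℕ} (κ : MvPolynomial (UpperIndex p) ℚ) : Prop :=
  ∃ G : DG p, κ ∈ G.hardConstraints

/-- Generalized faithfulness of the precision matrix `T` to `G`. -/
def GFaithful {p : ℕ} (T : Matrix (Fin p) (Fin p) ℝ) (G : DG p) : Prop :=
  ∀ κ : MvPolynomial (UpperIndex p) ℚ, IsHardConstraint κ →
    (Satisfies T κ ↔ κ ∈ G.hardConstraints)

namespace DG

variable {p : ℕ}

/-- The minimal-edges property of a graph: a graph that has no more edges and that only relaxes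
hard constraints of `G` has the same hard constraints as `G`. -/
def MinimalEdges (G : DG p) : Prop :=
  ∀ G' : DG p, G'.hardConstraints ⊆ G.hardConstraints → G'.numEdges ≤ G.numEdges →
    G'.hardConstraints = G.hardConstraints

/-- Quasi equivalence: the distributions which both graphs can generate form a set of nonzero
`d`-dimensional (Hausdorff, that is Lebesgue surface) measure, where `d` is the dimension of the
set of all distributions generated by one of the two graphs. -/
def QuasiEquiv (G₁ G₂ : DG p) : Prop :=
  Measure.hausdorffMeasure (dimH (symEntries '' (G₁.distSet ∪ G₂.distSet))).toReal
    (symEntries '' (G₁.distSet ∩ G₂.distSet)) ≠ 0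

end DG

/-- The negative Gaussian log-likelihood of the `n × p` data matrix, up to an additive constant. -/
noncomputable def negLogLik {n p : ℕ} (X : Matrix (Fin n) (Fin p) ℝ)
    (B : Matrix (Fin p) (Fin p) ℝ) (σ2 : Fin p → ℝ) : ℝ :=
  -(n : ℝ) * Real.log |(1 - B).det| +
    ∑ i, ((n : ℝ) / 2 * Real.log (σ2 i) + 1 / (2 * σ2 i) * ∑ k, (X k i - (X * B) k i) ^ 2)

/-- `‖B‖₀`, the number of nonzero entries. -/
noncomputable def l0norm {p : ℕ} (B : Matrix (Fin p) (Fin p) ℝ) : ℕ :=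
  {e : Fin p × Fin p | B e.1 e.2 ≠ 0}.ncard

/-- The `ℓ₀`-penalized score. -/
noncomputable def l0Score {n p : ℕ} (X : Matrix (Fin n) (Fin p) ℝ) (lam : ℝ)
    (B : Matrix (Fin p) (Fin p) ℝ) (σ2 : Fin p → ℝ) : ℝ :=
  negLogLik X B σ2 + lam * (l0norm B : ℝ)

/-- `(G, B, σ²)` attains the minimum, over all graphs and all their parameters, of the score. -/
structure IsGlobalMinimizer {n p : ℕ} (X : Matrix (Fin n) (Fin p) ℝ) (lam : ℝ)
    (G : DG p) (B : Matrix (Fin p) (Fin p) ℝ) (σ2 : Fin p → ℝ) : Prop where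
  feasible : G.IsParam B σ2
  minimal : ∀ (G' : DG p) (B' : Matrix (Fin p) (Fin p) ℝ) (σ2' : Fin p → ℝ),
    G'.IsParam B' σ2' → l0Score X lam B σ2 ≤ l0Score X lam B' σ2'

/-- `G` is the graph of the weight matrix `B`: its edges are the nonzero entries of `B`. -/
def IsGraphOf {p : ℕ} (G : DG p) (B : Matrix (Fin p) (Fin p) ℝ) : Prop :=
  ∀ i j, G.Adj i j ↔ B i j ≠ 0

/-- `Ghat` is an output of the `ℓ₀`-penalized maximum likelihood estimator: the graph of the weight
matrix of a global minimizer. -/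
def IsL0Output {n p : ℕ} (X : Matrix (Fin n) (Fin p) ℝ) (lam : ℝ) (Ghat : DG p) : Prop :=
  ∃ G B σ2, IsGlobalMinimizer X lam G B σ2 ∧ IsGraphOf Ghat B

/-!
The precision matrices of a graph `G` are the Gram matrices `Q * Qᵀ` of the invertible matrices
`Q` with nonzero diagonal in a linear space, `DG.patternSpace G`: the off-diagonal support of `Q`
lies in the edge set. Dropping the conditions on the diagonal and the determinant only adds limits
of precision matrices of `G`, and all polynomial constraints of `G` persist on them. The theorem
combines the usual consistency argument for a likelihood with penalty `log n / 2` per parameter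
with an algebraic fact about faithful points.

*Consistency.* Let `Q` be the factor of the true precision matrix, and express everything in the
coordinates in which `Q` is the identity. Up to scale and a constant, the negative log-likelihood
becomes `gaussLoss M T`, where `M` is the second moment matrix of the normalized noise. By
Chebyshev's inequality, `‖M - 1‖² ≤ log n / (4 n)` with probability tending to one
(`tendsto_measure_lt_sqDistOne`). The rest is deterministic. The loss is coercive, so that a
minimizer exists in every pattern space; a permutation of its columns makes the diagonal nonzero
without raising the number of edges (`DG.exists_isGlobalMinimizer`). The best possible loss is
smaller than the loss of the truth by a term quadratic in `M - 1`, worth less than one edge, so no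
output has more edges than a graph that generates the true precision matrix
(`DG.numEdges_le_of_isL0Output`). A graph whose pattern space contains no factor of the true
precision matrix pays a fixed amount per sample (`exists_gap_gaussLoss`), so it is not an output
for large `n`.

*Algebra.* Let `Ghat` be an output, so that the true precision matrix `T` is a limit of `Θ(Ghat)`,
and faithfulness with the minimality of edges gives `H(Ghat) = H(Gstar)`. If some off-diagonal
entry `T i j` is nonzero, then `f * Θ i j` is a hard constraint of the graph without edges for
every nonzero polynomial `f`. Hence faithfulness, applied to this product, shows that a polynomial
that vanishes at `T` vanishes on `Θ(Gstar)`, and then on `Θ(Ghat)`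
(`DG.isDistConstraint_of_gFaithful`). So `T` is a generic point for both graphs. If `T` is
diagonal, then both sets of precision matrices consist of all positive diagonal matrices.

*Geometry.* Choose a maximal set `J` of algebraically independent entries of a generic point
`T = Q * Qᵀ`. Apply to the entries of `Q` a derivation of `ℝ` with prescribed values on the
entries in `J`: the result is a tangent vector of the pattern space with that image. So the map
from the pattern space to the entries in `J` is a submersion at `Q`
(`eventually_map_nhds_gramEntries`). The remaining entries are simple zeros of polynomials over
those in `J`, so near `T` both sets of precision matrices are parts of one Lipschitz graph over
the entries in `J`, and both project onto open sets. Every precision matrix of either graph has at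
most `J.card` algebraically independent entries, which bounds the dimension of the union by
`J.card` (`dimH_setOf_trdegLE_le`). Hence the intersection has positive `J.card`-dimensional
measure, and `J.card` is the dimension of the union (`DG.quasiEquiv_of_generic`).
-/

/-! ### Derivations of the real numbers -/

open scoped IntermediateField.algebraAdjoinAdjoin in
/-- The real numbers are formally smooth over a polynomial ring in a transcendence basis: a
localization followed by a separable algebraic extension. -/
theorem formallySmooth_adjoin_of_isTranscendenceBasis {s : Set ℝ}
    (hs : IsTranscendenceBasis ℚ ((↑) : s → ℝ)) :
    Algebra.FormallySmooth (Algebra.adjoin ℚ s) ℝ := by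
  have h1 : Algebra.FormallySmooth (Algebra.adjoin ℚ s) (IntermediateField.adjoin ℚ s) :=
    .of_isLocalization (nonZeroDivisors _)
  have halg : Algebra.IsAlgebraic (IntermediateField.adjoin ℚ s) ℝ := by
    have := hs.isAlgebraic_field
    rwa [Subtype.range_coe] at this
  have h2 : Algebra.FormallyEtale (IntermediateField.adjoin ℚ s) ℝ :=
    Algebra.FormallyEtale.of_isSeparable _ ℝ
  exact .comp _ (IntermediateField.adjoin ℚ s) _

/-- Algebraically independent reals can be given arbitrary values by a derivation of `ℝ`. The
derivation is the infinitesimal part of a ring homomorphism from `ℝ` to the dual numbers, which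
formal smoothness extends from the polynomial ring in a transcendence basis. -/
theorem exists_derivation_of_algebraicIndependent {ι : Type} {x : ι → ℝ}
    (hx : AlgebraicIndependent ℚ x) (c : ι → ℝ) :
    ∃ D : ℝ → ℝ, (∀ a b, D (a + b) = D a + D b) ∧ (∀ a b, D (a * b) = a * D b + D a * b) ∧
      ∀ i, D (x i) = c i := by
  obtain ⟨s, hxs, hs⟩ := exists_isTranscendenceBasis_superset (R := ℚ) (s := Set.range x)
    hx.coe_range
  have hsm := formallySmooth_adjoin_of_isTranscendenceBasis hs
  have hinj : Function.Injective x := hx.injective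
  -- The homomorphism to be extended sends a basis element `y` to `y + ε c i` if `y = x i`.
  let v : s → DualNumber ℝ := fun y => TrivSqZeroExt.inl (y : ℝ) +
    TrivSqZeroExt.inr (Function.extend x c 0 y)
  let e : MvPolynomial s ℚ ≃ₐ[ℚ] Algebra.adjoin ℚ s :=
    (hs.1.aevalEquiv).trans (Subalgebra.equivOfEq _ _ (by rw [Subtype.range_coe]))
  have he : ∀ y : s, ((e (MvPolynomial.X y) : Algebra.adjoin ℚ s) : ℝ) = y := by
    intro y
    simp [e]
  let ψ : Algebra.adjoin ℚ s →ₐ[ℚ] DualNumber ℝ :=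
    (MvPolynomial.aeval v).comp e.symm.toAlgHom
  have hψ : ∀ a : Algebra.adjoin ℚ s, TrivSqZeroExt.fst (ψ a) = a := by
    have h : ((TrivSqZeroExt.fstHom ℚ ℝ ℝ).comp ψ).comp e.toAlgHom =
        ((Algebra.adjoin ℚ s).val).comp e.toAlgHom := by
      apply MvPolynomial.algHom_ext
      intro y
      have h2 := he y
      simp only [AlgHom.comp_apply, AlgEquiv.coe_toAlgHom, Subalgebra.coe_val] at h2 ⊢
      rw [h2]
      simp [ψ, v]
    intro a
    have := DFunLike.congr_fun h (e.symm a)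
    simpa using this
  let _ : Algebra (Algebra.adjoin ℚ s) (DualNumber ℝ) := ψ.toRingHom.toAlgebra
  have hmap : ∀ a : Algebra.adjoin ℚ s, algebraMap _ (DualNumber ℝ) a = ψ a := fun _ => rfl
  let g : DualNumber ℝ →ₐ[Algebra.adjoin ℚ s] ℝ :=
    { (TrivSqZeroExt.fstHom ℚ ℝ ℝ).toRingHom with
      commutes' := fun a => hψ a }
  have hg : Function.Surjective g := fun r => ⟨TrivSqZeroExt.inl r, rfl⟩
  have hg' : IsNilpotent (RingHom.ker (g : DualNumber ℝ →+* ℝ)) := by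
    refine ⟨2, ?_⟩
    rw [Ideal.zero_eq_bot, eq_bot_iff]
    refine (pow_two (M := Ideal (DualNumber ℝ)) _).le.trans (Ideal.mul_le.2 fun a ha b hb => ?_)
    have ha' : TrivSqZeroExt.fst a = 0 := ha
    have hb' : TrivSqZeroExt.fst b = 0 := hb
    rw [Ideal.mem_bot]
    ext <;> simp [ha', hb']
  let F := Algebra.FormallySmooth.liftOfSurjective
    (AlgHom.id (Algebra.adjoin ℚ s) ℝ) g hg hg'
  have hF : ∀ r, TrivSqZeroExt.fst (F r) = r := fun r =>
    Algebra.FormallySmooth.liftOfSurjective_apply (AlgHom.id (Algebra.adjoin ℚ s) ℝ) g hg hg' r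
  refine ⟨fun r => TrivSqZeroExt.snd (F r), fun a b => by simp, fun a b => ?_, fun i => ?_⟩
  · simp only [map_mul, TrivSqZeroExt.snd_mul, hF, smul_eq_mul, MulOpposite.smul_eq_mul_unop,
      MulOpposite.unop_op]
  · have hmem : x i ∈ s := hxs ⟨i, rfl⟩
    have h1 := he ⟨x i, hmem⟩
    have h2 : F (x i) = ψ (e (MvPolynomial.X ⟨x i, hmem⟩)) := by
      rw [← hmap, ← F.commutes]
      exact congrArg F h1.symm
    have h3 : ψ (e (MvPolynomial.X ⟨x i, hmem⟩)) = v ⟨x i, hmem⟩ := by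
      simp [ψ]
    change TrivSqZeroExt.snd (F (x i)) = c i
    rw [h2, h3]
    simp [v, hinj.extend_apply]

/-! ### Gram matrices of matrices with a prescribed pattern -/

/-- If `f` has a surjective strict derivative at `a`, then `f` is open at all points near `a`. -/
theorem HasStrictFDerivAt.eventually_map_nhds_eq {E F : Type*} [NormedAddCommGroup E]
    [NormedSpace ℝ E] [CompleteSpace E] [NormedAddCommGroup F] [NormedSpace ℝ F] [CompleteSpace F]
    {f : E → F} {f' : E →L[ℝ] F} {a : E} (hf : HasStrictFDerivAt f f' a)
    (h : f'.range = ⊤) : ∀ᶠ x in 𝓝 a, map f (𝓝 x) = 𝓝 (f x) := by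
  let f'symm := f'.nonlinearRightInverseOfSurjective h
  have f'symm_pos : 0 < f'symm.nnnorm := f'.nonlinearRightInverseOfSurjective_nnnorm_pos h
  obtain ⟨s, hs, happ⟩ := hf.approximates_deriv_on_nhds (c := f'symm.nnnorm⁻¹ / 2)
    (Or.inr (by simp [f'symm_pos]))
  filter_upwards [eventually_mem_nhds_iff.2 hs] with x hx
  refine happ.map_nhds_eq f'symm hx (Or.inr (NNReal.half_lt_self ?_))
  simp [f'symm_pos.ne']

/-- The entries `(Q Qᵀ) i j`, `i ≤ j`, of the Gram matrix of the rows of `Q`. -/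
def gramEntries {p : ℕ} (Q : Fin p → Fin p → ℝ) : UpperIndex p → ℝ :=
  fun e => ∑ l, Q e.1.1 l * Q e.1.2 l

namespace DG

variable {p : ℕ}

/-- The matrices whose off-diagonal support lies in the edge set of `G`. -/
def patternSpace (G : DG p) : Submodule ℝ (Fin p → Fin p → ℝ) where
  carrier := {Q | ∀ i j, i ≠ j → ¬ G.Adj i j → Q i j = 0}
  add_mem' := by
    intro a b ha hb i j hij h
    simp [ha i j hij h, hb i j hij h]
  zero_mem' := by simp
  smul_mem' := by
    intro c a ha i j hij h
    simp [ha i j hij h]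

end DG

theorem hasStrictFDerivAt_gramEntries {p : ℕ} (W : Submodule ℝ (Fin p → Fin p → ℝ)) (Q : W) :
    ∃ f' : W →L[ℝ] (UpperIndex p → ℝ),
      HasStrictFDerivAt (fun R : W => gramEntries R) f' Q ∧
      ∀ V : W, ∀ e, f' V e =
        ∑ l, (Q.1 e.1.1 l * V.1 e.1.2 l + Q.1 e.1.2 l * V.1 e.1.1 l) := by
  let ev : Fin p → Fin p → (W →L[ℝ] ℝ) := fun i j =>
    ((ContinuousLinearMap.proj j).comp (ContinuousLinearMap.proj (R := ℝ)
      (φ := fun _ : Fin p => Fin p → ℝ) i)).comp W.subtypeL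
  have hev : ∀ i j, HasStrictFDerivAt (fun R : W => R.1 i j) (ev i j) Q := fun i j =>
    (ev i j).hasStrictFDerivAt
  refine ⟨ContinuousLinearMap.pi fun e => ∑ l,
    (Q.1 e.1.1 l • ev e.1.2 l + Q.1 e.1.2 l • ev e.1.1 l), ?_, ?_⟩
  · rw [hasStrictFDerivAt_pi]
    intro e
    exact HasStrictFDerivAt.fun_sum fun l _ => (hev e.1.1 l).mul (hev e.1.2 l)
  · intro V e
    simp [ev]

/-- At a matrix `Q` some of whose Gram entries are algebraically independent over `ℚ`, the map to
these entries is a submersion: applying a derivation of `ℝ` to the entries of `Q` produces a tangent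
vector with any prescribed image. -/
theorem eventually_map_nhds_gramEntries {p : ℕ} (G : DG p) (Q : G.patternSpace)
    (J : Finset (UpperIndex p))
    (hJ : AlgebraicIndependent ℚ (fun e : J => gramEntries Q.1 e)) :
    ∀ᶠ R : G.patternSpace in 𝓝 Q,
      map (fun R : G.patternSpace => fun e : J => gramEntries R.1 e) (𝓝 R) =
        𝓝 (fun e : J => gramEntries R.1 e) := by
  obtain ⟨f', hf', hval⟩ := hasStrictFDerivAt_gramEntries G.patternSpace Q
  let pr : (UpperIndex p → ℝ) →L[ℝ] (J → ℝ) :=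
    ContinuousLinearMap.pi fun e => ContinuousLinearMap.proj (e : UpperIndex p)
  have hcomp : HasStrictFDerivAt (fun R : G.patternSpace => fun e : J => gramEntries R.1 e)
      (pr.comp f') Q := pr.hasStrictFDerivAt.comp Q hf'
  refine hcomp.eventually_map_nhds_eq ?_
  rw [LinearMap.range_eq_top]
  intro c
  obtain ⟨D, hadd, hmul, hD⟩ := exists_derivation_of_algebraicIndependent hJ c
  have h0 : D 0 = 0 := by
    have := hadd 0 0
    simp at this
    exact this
  have hsum : ∀ (f : Fin p → ℝ), D (∑ l, f l) = ∑ l, D (f l) := fun f =>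
    map_sum (⟨⟨D, h0⟩, hadd⟩ : ℝ →+ ℝ) f Finset.univ
  refine ⟨⟨fun i j => D (Q.1 i j), fun i j hij h => ?_⟩, ?_⟩
  · simp only [Q.2 i j hij h, h0]
  · ext e
    have : (pr.comp f') ⟨fun i j => D (Q.1 i j), fun i j hij h => by
        simp only [Q.2 i j hij h, h0]⟩ e = D (gramEntries Q.1 e) := by
      simp only [ContinuousLinearMap.comp_apply, pr, ContinuousLinearMap.coe_pi',
        ContinuousLinearMap.proj_apply, hval, gramEntries, hsum, hmul]
      refine Finset.sum_congr rfl fun l _ => by ring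
    exact this.trans (hD e)

/-! ### Models as matrices with a prescribed pattern -/

/-- The square root factor `(I - B) Ω^(-1/2)` of the precision matrix. -/
noncomputable def precisionFactor {p : ℕ} (B : Matrix (Fin p) (Fin p) ℝ) (σ2 : Fin p → ℝ) :
    Matrix (Fin p) (Fin p) ℝ :=
  (1 - B) * Matrix.diagonal (fun i => (√(σ2 i))⁻¹)

theorem precisionFactor_apply {p : ℕ} (B : Matrix (Fin p) (Fin p) ℝ) (σ2 : Fin p → ℝ)
    (i j : Fin p) : precisionFactor B σ2 i j = (1 - B) i j * (√(σ2 j))⁻¹ := by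
  simp [precisionFactor, Matrix.mul_diagonal]

/-- The weight matrix of the parameter with `(I - B) Ω^(-1/2) = Q`, up to the signs of the columns
of `Q`; its variances are `(Q i i ^ 2)⁻¹`. The diagonal of `Q` has to be free of zeros. -/
noncomputable def weightsOfFactor {p : ℕ} (Q : Matrix (Fin p) (Fin p) ℝ) :
    Matrix (Fin p) (Fin p) ℝ :=
  1 - Q * Matrix.diagonal (fun i => (Q i i)⁻¹)

theorem weightsOfFactor_apply {p : ℕ} (Q : Matrix (Fin p) (Fin p) ℝ) (i j : Fin p) :
    weightsOfFactor Q i j = (1 : Matrix (Fin p) (Fin p) ℝ) i j - Q i j * (Q j j)⁻¹ := by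
  simp [weightsOfFactor, Matrix.mul_diagonal]

theorem weightsOfFactor_ne_zero_iff {p : ℕ} {Q : Matrix (Fin p) (Fin p) ℝ}
    (hdiag : ∀ i, Q i i ≠ 0) (i j : Fin p) :
    weightsOfFactor Q i j ≠ 0 ↔ i ≠ j ∧ Q i j ≠ 0 := by
  rw [weightsOfFactor_apply]
  by_cases hij : i = j
  · subst hij
    simp [hdiag]
  · simp [hij, Matrix.one_apply_ne hij, hdiag]

namespace DG

variable {p : ℕ}

theorem IsParam.diag_eq_zero {G : DG p} {B : Matrix (Fin p) (Fin p) ℝ} {σ2 : Fin p → ℝ}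
    (h : G.IsParam B σ2) (i : Fin p) : B i i = 0 := by
  by_contra hne
  exact G.loopless i (h.supp i i hne)

theorem IsParam.precisionFactor_diag_ne_zero {G : DG p} {B : Matrix (Fin p) (Fin p) ℝ}
    {σ2 : Fin p → ℝ} (h : G.IsParam B σ2) (i : Fin p) : precisionFactor B σ2 i i ≠ 0 := by
  rw [precisionFactor_apply, Matrix.sub_apply, h.diag_eq_zero i, Matrix.one_apply_eq]
  simpa using (Real.sqrt_pos.2 (h.pos i)).ne'

theorem IsParam.precisionFactor_det_ne_zero {G : DG p} {B : Matrix (Fin p) (Fin p) ℝ}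
    {σ2 : Fin p → ℝ} (h : G.IsParam B σ2) : (precisionFactor B σ2).det ≠ 0 := by
  rw [precisionFactor, Matrix.det_mul, Matrix.det_diagonal]
  refine mul_ne_zero h.nonsing (Finset.prod_ne_zero_iff.2 fun i _ => ?_)
  simpa using (Real.sqrt_pos.2 (h.pos i)).ne'

theorem precisionFactor_mem_patternSpace {G : DG p} {B : Matrix (Fin p) (Fin p) ℝ}
    (hB : ∀ i j, B i j ≠ 0 → G.Adj i j) (σ2 : Fin p → ℝ) :
    precisionFactor B σ2 ∈ G.patternSpace := by
  intro i j hij hadj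
  have hz : B i j = 0 := by
    by_contra hne
    exact hadj (hB i j hne)
  rw [precisionFactor_apply, Matrix.sub_apply, hz, Matrix.one_apply_ne hij]
  simp

theorem IsParam.precisionFactor_mul_transpose {G : DG p} {B : Matrix (Fin p) (Fin p) ℝ}
    {σ2 : Fin p → ℝ} (h : G.IsParam B σ2) :
    precisionFactor B σ2 * (precisionFactor B σ2)ᵀ = precisionMatrix B σ2 := by
  rw [precisionFactor, precisionMatrix, Matrix.transpose_mul, Matrix.diagonal_transpose,
    Matrix.mul_assoc, ← Matrix.mul_assoc (Matrix.diagonal _) (Matrix.diagonal _),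
    Matrix.diagonal_mul_diagonal, ← Matrix.mul_assoc]
  congr 3
  ext i
  rw [← mul_inv, Real.mul_self_sqrt (h.pos i).le]

theorem isParam_weightsOfFactor {G : DG p} {Q : Matrix (Fin p) (Fin p) ℝ}
    (hsupp : ∀ i j, i ≠ j → Q i j ≠ 0 → G.Adj i j)
    (hdiag : ∀ i, Q i i ≠ 0) (hdet : Q.det ≠ 0) :
    G.IsParam (weightsOfFactor Q) (fun i => (Q i i ^ 2)⁻¹) where
  supp i j h := by
    obtain ⟨hij, hne⟩ := (weightsOfFactor_ne_zero_iff hdiag i j).1 h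
    exact hsupp i j hij hne
  pos i := by
    have := hdiag i
    positivity
  nonsing := by
    rw [weightsOfFactor, sub_sub_cancel, Matrix.det_mul, Matrix.det_diagonal]
    exact mul_ne_zero hdet (Finset.prod_ne_zero_iff.2 fun i _ => inv_ne_zero (hdiag i))

theorem precisionMatrix_weightsOfFactor {Q : Matrix (Fin p) (Fin p) ℝ}
    (hdiag : ∀ i, Q i i ≠ 0) :
    precisionMatrix (weightsOfFactor Q) (fun i => (Q i i ^ 2)⁻¹) = Q * Qᵀ := by
  rw [precisionMatrix, weightsOfFactor, sub_sub_cancel, Matrix.transpose_mul,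
    Matrix.diagonal_transpose]
  rw [Matrix.mul_assoc Q, Matrix.diagonal_mul_diagonal, Matrix.mul_assoc Q,
    ← Matrix.mul_assoc (Matrix.diagonal _), Matrix.diagonal_mul_diagonal]
  have : (fun i => (Q i i)⁻¹ * ((Q i i ^ 2)⁻¹)⁻¹ * (Q i i)⁻¹) = fun _ => (1 : ℝ) := by
    ext i
    have := hdiag i
    field_simp
  rw [this, Matrix.diagonal_one, Matrix.one_mul]

/-- The distribution set consists of the Gram matrices `Q Qᵀ` of the invertible matrices `Q` in the
pattern space with nonzero diagonal. -/
theorem mem_distSet_iff {G : DG p} {T : Matrix (Fin p) (Fin p) ℝ} :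
    T ∈ G.distSet ↔ ∃ Q : Matrix (Fin p) (Fin p) ℝ, Q ∈ G.patternSpace ∧ (∀ i, Q i i ≠ 0) ∧
      Q.det ≠ 0 ∧ T = Q * Qᵀ := by
  constructor
  · rintro ⟨B, σ2, h, rfl⟩
    exact ⟨precisionFactor B σ2, precisionFactor_mem_patternSpace h.supp σ2,
      h.precisionFactor_diag_ne_zero, h.precisionFactor_det_ne_zero,
      h.precisionFactor_mul_transpose.symm⟩
  · rintro ⟨Q, hQ, hdiag, hdet, rfl⟩
    refine ⟨weightsOfFactor Q, fun i => (Q i i ^ 2)⁻¹, isParam_weightsOfFactor ?_ hdiag hdet,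
      (precisionMatrix_weightsOfFactor hdiag).symm⟩
    intro i j hij hne
    by_contra hadj
    exact hne (hQ i j hij hadj)

theorem symEntries_mul_transpose (Q : Matrix (Fin p) (Fin p) ℝ) :
    symEntries (Q * Qᵀ) = gramEntries Q := by
  ext e
  simp [symEntries, gramEntries, Matrix.mul_apply]

theorem mul_transpose_eq_of_gramEntries_eq {Q R : Matrix (Fin p) (Fin p) ℝ}
    (h : gramEntries Q = gramEntries R) : Q * Qᵀ = R * Rᵀ := by
  ext i j
  rcases le_total i j with hij | hij
  · simpa [gramEntries, Matrix.mul_apply] using congrFun h ⟨(i, j), hij⟩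
  · simpa [gramEntries, Matrix.mul_apply, mul_comm] using congrFun h ⟨(j, i), hij⟩

theorem continuous_gramEntries :
    Continuous (gramEntries : (Fin p → Fin p → ℝ) → UpperIndex p → ℝ) := by
  unfold gramEntries
  fun_prop

theorem continuous_patternSpace_apply {G : DG p} (i j : Fin p) :
    Continuous fun R : G.patternSpace => R.1 i j :=
  (continuous_apply_apply i j).comp continuous_subtype_val

/-- The identity matrix as an element of the pattern space. -/
def patternOne (G : DG p) : G.patternSpace :=
  ⟨fun i j => if i = j then 1 else 0, fun _ _ hij _ => if_neg hij⟩

theorem of_patternOne (G : DG p) : Matrix.of G.patternOne.1 = 1 := by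
  ext i j
  simp [patternOne, Matrix.one_apply]

theorem eventually_det_ne_zero {G : DG p} {Q : G.patternSpace}
    (h : (Matrix.of Q.1).det ≠ 0) :
    ∀ᶠ R : G.patternSpace in 𝓝 Q, (Matrix.of R.1).det ≠ 0 := by
  have : Continuous fun R : G.patternSpace => (Matrix.of R.1).det :=
    Continuous.matrix_det continuous_subtype_val
  exact this.continuousAt.eventually_ne h

theorem eventually_diag_ne_zero {G : DG p} {Q : G.patternSpace} (h : ∀ i, Q.1 i i ≠ 0) :
    ∀ᶠ R : G.patternSpace in 𝓝 Q, ∀ i, R.1 i i ≠ 0 := by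
  rw [eventually_all]
  intro i
  exact (continuous_patternSpace_apply i i).continuousAt.eventually_ne (h i)

/-- Matrices with nonzero diagonal are dense in the pattern space. -/
theorem frequently_diag_ne_zero (G : DG p) (Q : G.patternSpace) :
    ∃ᶠ R : G.patternSpace in 𝓝 Q, ∀ i, R.1 i i ≠ 0 := by
  let I : G.patternSpace := G.patternOne
  have hc : Tendsto (fun t : ℝ => Q + t • I) (𝓝[≠] 0) (𝓝 Q) := by
    have h1 : Continuous fun t : ℝ => Q + t • I := by fun_prop
    have h2 := h1.tendsto 0
    rw [zero_smul, add_zero] at h2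
    exact h2.mono_left nhdsWithin_le_nhds
  refine hc.frequently (Eventually.frequently ?_)
  rw [eventually_all]
  intro i
  by_cases h0 : Q.1 i i = 0
  · filter_upwards [self_mem_nhdsWithin] with t ht
    simpa [I, h0, patternOne] using ht
  · have h1 : Continuous fun t : ℝ => (Q + t • I).1 i i :=
      (continuous_patternSpace_apply i i).comp (f := fun t : ℝ => Q + t • I) (by fun_prop)
    refine (h1.continuousAt.eventually_ne ?_).filter_mono nhdsWithin_le_nhds
    simpa using h0

theorem analyticOnNhd_aeval_gramEntries (G : DG p) (f : MvPolynomial (UpperIndex p) ℚ) :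
    AnalyticOnNhd ℝ (fun R : G.patternSpace => MvPolynomial.aeval (gramEntries R.1) f)
      Set.univ := by
  refine AnalyticOnNhd.aeval_mvPolynomial (fun e => ?_) f
  have hev : ∀ i j, AnalyticOnNhd ℝ (fun R : G.patternSpace => R.1 i j) Set.univ := fun i j =>
    (((ContinuousLinearMap.proj j).comp (ContinuousLinearMap.proj (R := ℝ)
      (φ := fun _ : Fin p => Fin p → ℝ) i)).comp G.patternSpace.subtypeL).analyticOnNhd _
  exact Finset.analyticOnNhd_fun_sum _ fun l _ => (hev e.1.1 l).mul (hev e.1.2 l)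

/-- Identity theorem: a polynomial in the Gram entries that vanishes near a point of the pattern
space vanishes on all of it. -/
theorem aeval_gramEntries_eq_zero_of_eventually {G : DG p} {f : MvPolynomial (UpperIndex p) ℚ}
    {Q : G.patternSpace}
    (h : ∀ᶠ R : G.patternSpace in 𝓝 Q, MvPolynomial.aeval (gramEntries R.1) f = 0)
    (R : G.patternSpace) : MvPolynomial.aeval (gramEntries R.1) f = 0 := by
  have := (analyticOnNhd_aeval_gramEntries G f).eq_of_eventuallyEq
    (g := fun _ => 0) analyticOnNhd_const h
  exact congrFun this R

/-- The points of the pattern space without zeros on the diagonal and with nonzero determinant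
form a neighbourhood of the identity, so a constraint of `G` vanishes on the whole pattern space.
-/
theorem IsDistConstraint.aeval_gramEntries {G : DG p} {f : MvPolynomial (UpperIndex p) ℚ}
    (hf : G.IsDistConstraint f) (Q : G.patternSpace) :
    MvPolynomial.aeval (gramEntries Q.1) f = 0 := by
  refine aeval_gramEntries_eq_zero_of_eventually (Q := G.patternOne) ?_ Q
  filter_upwards [eventually_det_ne_zero (Q := G.patternOne) (by simp [of_patternOne]),
    eventually_diag_ne_zero (Q := G.patternOne) (by simp [patternOne])] with R h1 h2
  have h3 := hf _ (mem_distSet_iff.2 ⟨Matrix.of R.1, R.2, h2, h1, rfl⟩)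
  rwa [Satisfies, symEntries_mul_transpose] at h3

/-- Every constraint of `G` also holds for the limits `Q Qᵀ` of elements of `Θ(G)`. -/
theorem IsDistConstraint.satisfies_mul_transpose {G : DG p}
    {f : MvPolynomial (UpperIndex p) ℚ} (hf : G.IsDistConstraint f)
    {Q : Matrix (Fin p) (Fin p) ℝ} (hQ : Q ∈ G.patternSpace) : Satisfies (Q * Qᵀ) f := by
  rw [Satisfies, symEntries_mul_transpose]
  exact hf.aeval_gramEntries ⟨Q, hQ⟩

/-- The ideal of the polynomials that vanish on `Θ(G)` is prime: the pattern space is connected and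
polynomials are analytic. -/
theorem IsDistConstraint.of_mul {G : DG p} {f g : MvPolynomial (UpperIndex p) ℚ}
    (hfg : G.IsDistConstraint (f * g)) {T : Matrix (Fin p) (Fin p) ℝ} (hT : T ∈ G.distSet)
    (hg : ¬ Satisfies T g) : G.IsDistConstraint f := by
  obtain ⟨Q, hQ, -, -, rfl⟩ := mem_distSet_iff.1 hT
  have hev : ∀ᶠ R : G.patternSpace in 𝓝 ⟨Q, hQ⟩,
      MvPolynomial.aeval (gramEntries R.1) f = 0 := by
    rw [Satisfies, symEntries_mul_transpose] at hg
    have hne := ((analyticOnNhd_aeval_gramEntries G g) ⟨Q, hQ⟩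
      trivial).continuousAt.eventually_ne hg
    filter_upwards [hne] with R hR
    have h1 := hfg.aeval_gramEntries R
    rw [map_mul] at h1
    exact (mul_eq_zero.1 h1).resolve_right hR
  intro T' hT'
  obtain ⟨R, hR, -, -, rfl⟩ := mem_distSet_iff.1 hT'
  rw [Satisfies, symEntries_mul_transpose]
  exact aeval_gramEntries_eq_zero_of_eventually hev ⟨R, hR⟩

end DG

/-! ### Transcendence degree and Hausdorff dimension -/

/-- The value at `(y, t)` of a polynomial in one variable over the polynomial ring in the
variables `κ`. -/
noncomputable def evalAt {κ : Type} (f : Polynomial (MvPolynomial κ ℚ)) (y : κ → ℝ) (t : ℝ) : ℝ :=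
  f.eval₂ (MvPolynomial.aeval y : MvPolynomial κ ℚ →ₐ[ℚ] ℝ).toRingHom t

/-- The number of algebraically independent coordinates of `v` over `ℚ` is at most `d`. -/
def TrdegLE {ι : Type} (d : ℕ) (v : ι → ℝ) : Prop :=
  ∀ J : Finset ι, AlgebraicIndependent ℚ (fun i : J => v i) → J.card ≤ d

theorem countable_mvPolynomial_rat (κ : Type) [Finite κ] : Countable (MvPolynomial κ ℚ) := by
  rw [← Cardinal.mk_le_aleph0_iff]
  refine MvPolynomial.cardinalMk_le_max.trans ?_
  simp

theorem countable_polynomial_mvPolynomial_rat (κ : Type) [Finite κ] :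
    Countable (Polynomial (MvPolynomial κ ℚ)) := by
  have := countable_mvPolynomial_rat κ
  rw [← Cardinal.mk_le_aleph0_iff] at this ⊢
  exact Polynomial.cardinalMk_le_max.trans (by simp)

/-- An algebraic number over an algebraically independent family is a simple zero of a polynomial:
take derivatives until the derivative no longer vanishes. -/
theorem exists_evalAt_eq_zero_derivative_ne_zero {κ : Type} {y : κ → ℝ}
    (hy : AlgebraicIndependent ℚ y) {t : ℝ} (f : Polynomial (MvPolynomial κ ℚ)) (hf : f ≠ 0)
    (h0 : evalAt f y t = 0) :
    ∃ g : Polynomial (MvPolynomial κ ℚ), evalAt g y t = 0 ∧ evalAt g.derivative y t ≠ 0 := by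
  induction hn : f.natDegree using Nat.strong_induction_on generalizing f with
  | _ n ih =>
    by_cases hd : evalAt f.derivative y t = 0
    · have hpos : f.natDegree ≠ 0 := by
        intro hz
        obtain ⟨a, rfl⟩ := Polynomial.natDegree_eq_zero.1 hz
        have ha : MvPolynomial.aeval y a = 0 := by simpa [evalAt] using h0
        rw [algebraicIndependent_iff] at hy
        exact hf (by rw [hy a ha, map_zero])
      refine ih _ (hn ▸ Polynomial.natDegree_derivative_lt hpos) f.derivative (fun h => hpos ?_)
        hd rfl
      exact Polynomial.derivative_eq_zero.1 h
    · exact ⟨f, h0, hd⟩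

theorem exists_evalAt_eq_zero_of_not_algebraicIndependent {κ : Type} {y : κ → ℝ} {t : ℝ}
    (h : ¬ AlgebraicIndependent ℚ (fun o : Option κ => o.elim t y)) :
    ∃ f : Polynomial (MvPolynomial κ ℚ), f ≠ 0 ∧ evalAt f y t = 0 := by
  rw [algebraicIndependent_iff] at h
  push Not at h
  obtain ⟨F, hF, hF0⟩ := h
  refine ⟨MvPolynomial.optionEquivLeft ℚ κ F, by simpa using hF0, ?_⟩
  rw [← hF]
  have : ((Polynomial.eval₂RingHom (MvPolynomial.aeval y : MvPolynomial κ ℚ →ₐ[ℚ] ℝ).toRingHom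
      t).comp (MvPolynomial.optionEquivLeft ℚ κ).toRingEquiv.toRingHom) =
      (MvPolynomial.aeval (fun o : Option κ => o.elim t y)).toRingHom := by
    refine MvPolynomial.ringHom_ext (fun r => ?_) (fun o => ?_)
    · simp
    · cases o <;> simp
  exact DFunLike.congr_fun this F

theorem hasStrictFDerivAt_evalAt {κ : Type} [Fintype κ] (f : Polynomial (MvPolynomial κ ℚ))
    (z : (κ → ℝ) × ℝ) :
    ∃ f' : (κ → ℝ) × ℝ →L[ℝ] ℝ,
      HasStrictFDerivAt (fun w : (κ → ℝ) × ℝ => evalAt f w.1 w.2) f' z ∧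
        f' (0, 1) = evalAt f.derivative z.1 z.2 := by
  have han : AnalyticAt ℝ (fun w : (κ → ℝ) × ℝ => evalAt f w.1 w.2) z := by
    simp only [evalAt, Polynomial.eval₂_eq_sum_range]
    refine Finset.analyticAt_fun_sum _ fun n _ => ?_
    refine AnalyticAt.mul ?_ (analyticAt_snd.pow n)
    refine AnalyticAt.aeval_mvPolynomial (f := fun w : (κ → ℝ) × ℝ => w.1) (fun i => ?_) _
    exact ((ContinuousLinearMap.proj (R := ℝ) (φ := fun _ : κ => ℝ) i).comp
      (ContinuousLinearMap.fst ℝ (κ → ℝ) ℝ)).analyticAt z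
  have hs := (han.contDiffAt (n := 1)).hasStrictFDerivAt one_ne_zero
  refine ⟨_, hs, ?_⟩
  have h1 : HasDerivAt (fun t : ℝ => ((z.1, t) : (κ → ℝ) × ℝ)) (0, 1) z.2 :=
    (hasDerivAt_const _ _).prodMk (hasDerivAt_id _)
  have h2 : HasDerivAt (fun t : ℝ => evalAt f z.1 t) (evalAt f.derivative z.1 z.2) z.2 := by
    simp only [evalAt, ← Polynomial.eval_map, ← Polynomial.derivative_map]
    exact Polynomial.hasDerivAt _ _
  have h3 := HasFDerivAt.comp_hasDerivAt (l := fun w : (κ → ℝ) × ℝ => evalAt f w.1 w.2)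
    (f := fun t : ℝ => ((z.1, t) : (κ → ℝ) × ℝ)) z.2 hs.hasFDerivAt h1
  exact h3.unique h2

/-- Near a zero of `f` at which the derivative in the last variable does not vanish, the last
coordinate of a zero of `f` is a Lipschitz function of the others. -/
theorem exists_lipschitz_of_evalAt_derivative_ne_zero {κ : Type} [Fintype κ]
    (f : Polynomial (MvPolynomial κ ℚ)) (z : (κ → ℝ) × ℝ)
    (hz : evalAt f.derivative z.1 z.2 ≠ 0) :
    ∃ C : ℝ, ∀ᶠ w in 𝓝 (z, z), evalAt f w.1.1 w.1.2 = 0 → evalAt f w.2.1 w.2.2 = 0 →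
      |w.1.2 - w.2.2| ≤ C * ‖w.1.1 - w.2.1‖ := by
  obtain ⟨f', hf', hval⟩ := hasStrictFDerivAt_evalAt f z
  set a := evalAt f.derivative z.1 z.2 with ha
  have hapos : 0 < |a| / 2 := by positivity
  refine ⟨(‖f'‖ + |a| / 2) / (|a| / 2), ?_⟩
  filter_upwards [hf'.isLittleO.def hapos] with w hw h1 h2
  rw [h1, h2] at hw
  set u := w.1.1 - w.2.1
  set s := w.1.2 - w.2.2
  have hsplit : w.1 - w.2 = (u, (0 : ℝ)) + s • ((0 : κ → ℝ), (1 : ℝ)) := by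
    ext <;> simp [u, s]
  have hf1 : f' (w.1 - w.2) = f' (u, 0) + s * a := by
    rw [hsplit, map_add, map_smul, hval, smul_eq_mul]
  have hu : |f' (u, 0)| ≤ ‖f'‖ * ‖u‖ := by
    refine (f'.le_opNorm (u, 0)).trans_eq ?_
    simp [Prod.norm_def]
  have hn : ‖w.1 - w.2‖ ≤ ‖u‖ + |s| := by
    rw [Prod.norm_def]
    exact max_le (le_add_of_nonneg_right (abs_nonneg _)) (le_add_of_nonneg_left (norm_nonneg _))
  rw [hf1] at hw
  simp only [sub_self, zero_sub, norm_neg, Real.norm_eq_abs] at hw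
  have h3 : |s| * |a| ≤ |f' (u, 0) + s * a| + |f' (u, 0)| := by
    rw [← abs_mul]
    calc |s * a| = |(f' (u, 0) + s * a) - f' (u, 0)| := by ring_nf
      _ ≤ _ := abs_sub _ _
  have h4 : |a| / 2 * ‖w.1 - w.2‖ ≤ |a| / 2 * (‖u‖ + |s|) :=
    mul_le_mul_of_nonneg_left hn hapos.le
  rw [div_mul_eq_mul_div, le_div_iff₀ hapos]
  nlinarith

/-- The points whose coordinates outside `J` are simple zeros of the polynomials `f k` over the
coordinates in `J`. -/
def simpleZeros {ι : Type} (J : Finset ι) (f : ι → Polynomial (MvPolynomial J ℚ)) :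
    Set (ι → ℝ) :=
  {v | ∀ k ∉ J, evalAt (f k) (fun i : J => v i) (v k) = 0 ∧
    evalAt (f k).derivative (fun i : J => v i) (v k) ≠ 0}

/-- Near a point of `simpleZeros J f`, the common zeros of the polynomials `f k` form a Lipschitz
graph over the coordinates in `J`. -/
theorem exists_dist_le_of_mem_simpleZeros {ι : Type} [Fintype ι] {J : Finset ι}
    {f : ι → Polynomial (MvPolynomial J ℚ)} {v : ι → ℝ} (hv : v ∈ simpleZeros J f) :
    ∃ C : NNReal, ∃ U ∈ 𝓝 v, ∀ x ∈ U, ∀ y ∈ U,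
      (∀ k ∉ J, evalAt (f k) (fun i : J => x i) (x k) = 0) →
      (∀ k ∉ J, evalAt (f k) (fun i : J => y i) (y k) = 0) →
      dist x y ≤ C * dist (fun i : J => x i) (fun i : J => y i) := by
  have key : ∀ k, ∃ C : ℝ, ∀ᶠ w : (ι → ℝ) × (ι → ℝ) in 𝓝 (v, v),
      (k ∉ J → evalAt (f k) (fun i : J => w.1 i) (w.1 k) = 0) →
      (k ∉ J → evalAt (f k) (fun i : J => w.2 i) (w.2 k) = 0) →
      |w.1 k - w.2 k| ≤ C * dist (fun i : J => w.1 i) (fun i : J => w.2 i) := by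
    intro k
    by_cases hk : k ∈ J
    · refine ⟨1, Eventually.of_forall fun w _ _ => ?_⟩
      rw [one_mul, ← Real.dist_eq]
      exact dist_le_pi_dist (fun i : J => w.1 i) (fun i : J => w.2 i) ⟨k, hk⟩
    · obtain ⟨C, hC⟩ := exists_lipschitz_of_evalAt_derivative_ne_zero (f k)
        (fun i : J => v i, v k) (hv k hk).2
      refine ⟨C, ?_⟩
      have hcont : Continuous fun w : (ι → ℝ) × (ι → ℝ) =>
          (((fun i : J => w.1 i), w.1 k), ((fun i : J => w.2 i), w.2 k)) := by fun_prop
      filter_upwards [hcont.continuousAt.eventually (p := fun w => _) hC] with w hw h1 h2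
      rw [dist_eq_norm]
      exact hw (h1 hk) (h2 hk)
  choose C hC using key
  have hall := eventually_all.2 hC
  rw [nhds_prod_eq] at hall
  obtain ⟨U, hU, hsub⟩ := mem_prod_same_iff.1 hall
  refine ⟨∑ k, (C k).toNNReal, U, hU, fun x hx y hy h1 h2 => ?_⟩
  have hd := dist_nonneg (x := fun i : J => x i) (y := fun i : J => y i)
  refine (dist_pi_le_iff (by positivity)).2 fun k => ?_
  rw [Real.dist_eq]
  refine (hsub (Set.mk_mem_prod hx hy) k (h1 k) (h2 k)).trans (mul_le_mul_of_nonneg_right ?_ hd)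
  push_cast
  exact (Real.le_coe_toNNReal _).trans
    (Finset.single_le_sum (f := fun k => ((C k).toNNReal : ℝ)) (fun i _ => NNReal.coe_nonneg _)
      (Finset.mem_univ k))

theorem dimH_simpleZeros_le {ι : Type} [Fintype ι] (J : Finset ι)
    (f : ι → Polynomial (MvPolynomial J ℚ)) : dimH (simpleZeros J f) ≤ J.card := by
  by_contra hlt
  obtain ⟨v, hv, hvt⟩ := exists_mem_nhdsWithin_lt_dimH_of_lt_dimH (not_le.1 hlt)
  obtain ⟨C, U, hU, hdist⟩ := exists_dist_le_of_mem_simpleZeros hv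
  have h1 := hvt (U ∩ simpleZeros J f)
    (inter_mem (mem_nhdsWithin_of_mem_nhds hU) self_mem_nhdsWithin)
  let g : ↥(U ∩ simpleZeros J f) → (J → ℝ) := fun x i => x.1 i
  have hg : AntilipschitzWith C g := by
    refine AntilipschitzWith.of_le_mul_dist fun x y => ?_
    exact hdist x.1 x.2.1 y.1 y.2.1 (fun k hk => (x.2.2 k hk).1) (fun k hk => (y.2.2 k hk).1)
  have h2 := hg.le_dimH_image Set.univ
  have h3 : dimH (g '' Set.univ) ≤ J.card := by
    refine (dimH_mono (Set.subset_univ _)).trans_eq ?_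
    rw [Real.dimH_univ_pi, Fintype.card_coe]
  have h4 := isometry_subtype_coe.dimH_image (Set.univ : Set ↥(U ∩ simpleZeros J f))
  rw [Set.image_univ, Subtype.range_coe] at h4
  exact absurd (h1.trans_le (h4.le.trans (h2.trans h3))) (lt_irrefl _)

/-- A maximal family of algebraically independent coordinates of `v`, and polynomials that exhibit
the other coordinates as algebraic over it. -/
theorem exists_mem_simpleZeros {ι : Type} [Fintype ι] (v : ι → ℝ) :
    ∃ (J : Finset ι) (f : ι → Polynomial (MvPolynomial J ℚ)),
      AlgebraicIndependent ℚ (fun i : J => v i) ∧ TrdegLE J.card v ∧ v ∈ simpleZeros J f := by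
  classical
  let S : Finset (Finset ι) := Finset.univ.filter fun J : Finset ι =>
    AlgebraicIndependent ℚ (fun i : J => v i)
  have hS : S.Nonempty := by
    refine ⟨∅, ?_⟩
    simp only [S, Finset.mem_filter, Finset.mem_univ, true_and]
    exact (algebraicIndependent_empty_type_iff ..).2 (algebraMap ℚ ℝ).injective
  obtain ⟨J, hJ, hmax⟩ := S.exists_max_image Finset.card hS
  simp only [S, Finset.mem_filter, Finset.mem_univ, true_and] at hJ hmax
  have key : ∀ k, ∃ f : Polynomial (MvPolynomial J ℚ), k ∉ J →
      evalAt f (fun i : J => v i) (v k) = 0 ∧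
        evalAt f.derivative (fun i : J => v i) (v k) ≠ 0 := by
    intro k
    by_cases hk : k ∈ J
    · exact ⟨0, fun h => absurd hk h⟩
    · have hnot : ¬ AlgebraicIndependent ℚ
          (fun o : Option J => o.elim (v k) (fun i : J => v i)) := by
        intro hind
        rw [← algebraicIndependent_equiv (Finset.subtypeInsertEquivOption hk)] at hind
        have h2 := hmax (insert k J) (by
          convert hind using 1
          ext ⟨i, hi⟩
          by_cases hik : i = k
          · simp [Finset.subtypeInsertEquivOption, hik]
          · simp [Finset.subtypeInsertEquivOption, hik])
        rw [Finset.card_insert_of_notMem hk] at h2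
        omega
      obtain ⟨f, hf, hf0⟩ := exists_evalAt_eq_zero_of_not_algebraicIndependent hnot
      obtain ⟨g, hg, hg'⟩ := exists_evalAt_eq_zero_derivative_ne_zero hJ f hf hf0
      exact ⟨g, fun _ => ⟨hg, hg'⟩⟩
  choose f hf using key
  exact ⟨J, f, hJ, hmax, hf⟩

/-- The points with at most `d` algebraically independent coordinates lie in a countable union of
local Lipschitz graphs over at most `d` coordinates. -/
theorem dimH_setOf_trdegLE_le {ι : Type} [Fintype ι] (d : ℕ) :
    dimH {v : ι → ℝ | TrdegLE d v} ≤ d := by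
  have hsub : {v : ι → ℝ | TrdegLE d v} ⊆
      ⋃ J : {J : Finset ι // J.card ≤ d}, ⋃ f : ι → Polynomial (MvPolynomial J.1 ℚ),
        simpleZeros J.1 f := by
    intro v hv
    obtain ⟨J, f, hJ, -, hf⟩ := exists_mem_simpleZeros v
    exact Set.mem_iUnion.2 ⟨⟨J, hv J hJ⟩, Set.mem_iUnion.2 ⟨f, hf⟩⟩
  refine (dimH_mono hsub).trans ?_
  rw [dimH_iUnion]
  refine iSup_le fun J => ?_
  have := countable_polynomial_mvPolynomial_rat J.1
  rw [dimH_iUnion]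
  refine iSup_le fun f => (dimH_simpleZeros_le J.1 f).trans ?_
  exact_mod_cast J.2

/-- The zeros of a nonzero rational polynomial have algebraically dependent coordinates, hence
form a set of dimension less than the number of variables. -/
theorem volume_setOf_aeval_eq_zero {ι : Type} [Fintype ι] {f : MvPolynomial ι ℚ} (hf : f ≠ 0) :
    volume {v : ι → ℝ | MvPolynomial.aeval v f = 0} = 0 := by
  rw [← hausdorffMeasure_pi_real]
  by_cases hcard : Fintype.card ι = 0
  · have := Fintype.card_eq_zero_iff.1 hcard
    have hempty : {v : ι → ℝ | MvPolynomial.aeval v f = 0} = ∅ := by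
      ext v
      obtain ⟨a, rfl⟩ := MvPolynomial.C_surjective ι f
      simpa using hf
    rw [hempty, measure_empty]
  have hdim : dimH {v : ι → ℝ | MvPolynomial.aeval v f = 0} ≤ (Fintype.card ι - 1 : ℕ) := by
    refine (dimH_mono fun v hv => ?_).trans (dimH_setOf_trdegLE_le _)
    intro J hJ
    by_contra hlt
    have hJuniv : J = Finset.univ := by
      rw [← Finset.card_eq_iff_eq_univ]
      have := Finset.card_le_univ J
      omega
    subst hJuniv
    have hind : AlgebraicIndependent ℚ v := by
      rw [← algebraicIndependent_equiv (Equiv.subtypeUnivEquiv (p := (· ∈ Finset.univ))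
        Finset.mem_univ)]
      exact hJ
    rw [algebraicIndependent_iff] at hind
    exact hf (hind f hv)
  have hlt : dimH {v : ι → ℝ | MvPolynomial.aeval v f = 0} <
      ((Fintype.card ι : NNReal) : ENNReal) := by
    refine hdim.trans_lt ?_
    rw [ENNReal.coe_natCast]
    exact_mod_cast Nat.sub_lt (Nat.pos_of_ne_zero hcard) one_pos
  have := hausdorffMeasure_of_dimH_lt hlt
  simpa using this

/-! ### Quasi-equivalence at a generic point -/

/-- The value of a polynomial at the coordinate `k` over the coordinates in `J` is the value of a
polynomial in all coordinates. -/
theorem exists_aeval_eq_evalAt {ι : Type} {J : Finset ι} (f : Polynomial (MvPolynomial J ℚ))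
    (k : ι) : ∃ F : MvPolynomial ι ℚ, ∀ v : ι → ℝ,
      MvPolynomial.aeval v F = evalAt f (fun i : J => v i) (v k) := by
  refine ⟨f.eval₂ (MvPolynomial.rename (R := ℚ) (Subtype.val : J → ι)).toRingHom
    (MvPolynomial.X k), fun v => ?_⟩
  have h := Polynomial.hom_eval₂ f
    (MvPolynomial.rename (R := ℚ) (Subtype.val : J → ι)).toRingHom
    (MvPolynomial.aeval v : MvPolynomial ι ℚ →ₐ[ℚ] ℝ).toRingHom (MvPolynomial.X k)
  have h2 : (MvPolynomial.aeval v : MvPolynomial ι ℚ →ₐ[ℚ] ℝ).toRingHom.comp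
      (MvPolynomial.rename (R := ℚ) (Subtype.val : J → ι)).toRingHom =
      (MvPolynomial.aeval (fun i : J => v i) : MvPolynomial J ℚ →ₐ[ℚ] ℝ).toRingHom := by
    refine MvPolynomial.ringHom_ext (fun r => ?_) (fun o => ?_) <;> simp
  rw [h2] at h
  simpa [evalAt] using h

/-- If every rational polynomial that vanishes at `v` vanishes at `w`, then `w` has no more
algebraically independent coordinates than `v`. -/
theorem TrdegLE.of_specialization {ι : Type} {d : ℕ} {v w : ι → ℝ} (hv : TrdegLE d v)
    (h : ∀ f : MvPolynomial ι ℚ, MvPolynomial.aeval v f = 0 → MvPolynomial.aeval w f = 0) :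
    TrdegLE d w := by
  intro J hJ
  refine hv J ?_
  rw [algebraicIndependent_iff] at hJ ⊢
  intro f hf
  refine hJ f ?_
  have := h (MvPolynomial.rename Subtype.val f) (by rwa [MvPolynomial.aeval_rename])
  rwa [MvPolynomial.aeval_rename] at this

namespace DG

variable {p : ℕ}

/-- A set of `d` coordinates certifies quasi-equivalence if the common distributions fill an open
set of values of these coordinates and no distribution has more than `d` algebraically independent
entries. -/
theorem quasiEquiv_of_projection {G₁ G₂ : DG p} (J : Finset (UpperIndex p)) {O : Set (J → ℝ)}
    (hO : IsOpen O) (hne : O.Nonempty)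
    (hsub : O ⊆ (fun (v : UpperIndex p → ℝ) (i : J) => v i) ''
      (symEntries '' (G₁.distSet ∩ G₂.distSet)))
    (htr : ∀ T ∈ G₁.distSet ∪ G₂.distSet, TrdegLE J.card (symEntries T)) :
    G₁.QuasiEquiv G₂ := by
  set A := symEntries '' (G₁.distSet ∩ G₂.distSet) with hA
  set U := symEntries '' (G₁.distSet ∪ G₂.distSet) with hU
  have hAU : A ⊆ U := Set.image_mono (Set.inter_subset_left.trans Set.subset_union_left)
  have hlip : LipschitzWith 1 (fun (v : UpperIndex p → ℝ) (i : J) => v i) :=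
    LipschitzWith.of_dist_le_mul fun v w => by
      rw [NNReal.coe_one, one_mul]
      exact (dist_pi_le_iff dist_nonneg).2 fun i => dist_le_pi_dist v w i
  have hpos : μH[(J.card : ℝ)] A ≠ 0 := by
    intro h0
    have h1 := hlip.hausdorffMeasure_image_le (d := (J.card : ℝ)) (Nat.cast_nonneg _) A
    rw [h0, mul_zero] at h1
    have h2 := (measure_mono hsub).trans h1
    have h3 : (μH[(J.card : ℝ)] : Measure (J → ℝ)) = volume := by
      rw [← hausdorffMeasure_pi_real, Fintype.card_coe]
    rw [h3] at h2
    exact (hO.measure_pos volume hne).ne' (le_antisymm h2 zero_le)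
  have hle : dimH U ≤ (J.card : ENNReal) := by
    refine (dimH_mono ?_).trans (dimH_setOf_trdegLE_le J.card)
    rintro _ ⟨T, hT, rfl⟩
    exact htr T hT
  have hge : (J.card : ENNReal) ≤ dimH U := by
    have h1 : μH[((J.card : NNReal) : ℝ)] A ≠ 0 := by simpa using hpos
    have h2 := le_dimH_of_hausdorffMeasure_ne_zero h1
    rw [ENNReal.coe_natCast] at h2
    exact h2.trans (dimH_mono hAU)
  have hdim : dimH U = (J.card : ENNReal) := le_antisymm hle hge
  rw [QuasiEquiv, ← hA, ← hU, hdim, ENNReal.toReal_natCast]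
  exact hpos

/-- Two graphs are quasi-equivalent if `Θ(G₁)` contains a point `T` that is also a limit of points
of `Θ(G₂)` and is generic for both graphs: every rational polynomial that vanishes at `T` vanishes
on both distribution sets. Near `T`, both distribution sets project onto neighbourhoods in a maximal
set of algebraically independent entries of `T`, and the other entries are determined by these. -/
theorem quasiEquiv_of_generic {G₁ G₂ : DG p} {T Q₂ : Matrix (Fin p) (Fin p) ℝ}
    (hT : T ∈ G₁.distSet) (hQ₂ : Q₂ ∈ G₂.patternSpace) (hTQ : T = Q₂ * Q₂ᵀ)
    (hgen₁ : ∀ f, Satisfies T f → G₁.IsDistConstraint f)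
    (hgen₂ : ∀ f, Satisfies T f → G₂.IsDistConstraint f) : G₁.QuasiEquiv G₂ := by
  obtain ⟨J, f, hJ, htr, hf⟩ := exists_mem_simpleZeros (symEntries T)
  obtain ⟨C, U, hU, hdist⟩ := exists_dist_le_of_mem_simpleZeros hf
  have hzero : ∀ G : DG p, (∀ f, Satisfies T f → G.IsDistConstraint f) →
      ∀ R : G.patternSpace, ∀ k ∉ J,
        evalAt (f k) (fun i : J => gramEntries R.1 i) (gramEntries R.1 k) = 0 := by
    intro G hG R k hk
    obtain ⟨F, hF⟩ := exists_aeval_eq_evalAt (f k) k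
    rw [← hF]
    refine (hG F ?_).aeval_gramEntries R
    rw [Satisfies, hF]
    exact (hf k hk).1
  obtain ⟨Q₁, hQ₁, hdiag₁, hdet₁, hTQ₁⟩ := mem_distSet_iff.1 hT
  have hdet₂ : (Matrix.of Q₂).det ≠ 0 := by
    intro h0
    have h1 : Q₁.det * Q₁.det = Q₂.det * Q₂.det := by
      rw [← Matrix.det_transpose Q₁, ← Matrix.det_transpose Q₂]
      nth_rw 1 [Matrix.det_transpose Q₁]
      nth_rw 1 [Matrix.det_transpose Q₂]
      rw [← Matrix.det_mul, ← Matrix.det_mul, ← hTQ₁, ← hTQ]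
    have h0' : Q₂.det = 0 := h0
    rw [h0', mul_zero] at h1
    exact hdet₁ (mul_self_eq_zero.1 h1)
  have hs₁ : symEntries T = gramEntries Q₁ := by rw [hTQ₁, symEntries_mul_transpose]
  have hs₂ : symEntries T = gramEntries Q₂ := by rw [hTQ, symEntries_mul_transpose]
  let π : (UpperIndex p → ℝ) → (J → ℝ) := fun v i => v i
  have hπ : Continuous π := by fun_prop
  have hgram : ∀ G : DG p, Continuous fun R : G.patternSpace => gramEntries R.1 := fun G =>
    continuous_gramEntries.comp continuous_subtype_val
  let A : (G : DG p) → Set G.patternSpace := fun G =>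
    {R | ((∀ i, R.1 i i ≠ 0) ∧ (Matrix.of R.1).det ≠ 0) ∧ gramEntries R.1 ∈ U}
  let P₁ : G₁.patternSpace := ⟨Q₁, hQ₁⟩
  let P₂ : G₂.patternSpace := ⟨Q₂, hQ₂⟩
  have hA₁ : A G₁ ∈ 𝓝 P₁ := by
    refine inter_mem (inter_mem (eventually_diag_ne_zero hdiag₁) (eventually_det_ne_zero hdet₁)) ?_
    refine (hgram G₁).continuousAt.preimage_mem_nhds ?_
    rwa [← hs₁]
  have hB₁ : (fun R : G₁.patternSpace => π (gramEntries R.1)) '' A G₁ ∈ 𝓝 (π (symEntries T)) := by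
    have h := (eventually_map_nhds_gramEntries G₁ P₁ J (by rw [hs₁] at hJ; exact hJ)).self_of_nhds
    rw [hs₁]
    exact h ▸ image_mem_map hA₁
  -- A point of the pattern space of `G₂` near `Q₂` where all conditions below are open.
  obtain ⟨R, hRdiag, hRdet, hRU, hRmap, hRB⟩ : ∃ R : G₂.patternSpace,
      (∀ i, R.1 i i ≠ 0) ∧ (Matrix.of R.1).det ≠ 0 ∧ U ∈ 𝓝 (gramEntries R.1) ∧
      map (fun R : G₂.patternSpace => π (gramEntries R.1)) (𝓝 R) = 𝓝 (π (gramEntries R.1)) ∧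
      (fun R : G₁.patternSpace => π (gramEntries R.1)) '' A G₁ ∈ 𝓝 (π (gramEntries R.1)) := by
    have h1 := eventually_det_ne_zero (Q := P₂) hdet₂
    have h2 : ∀ᶠ R : G₂.patternSpace in 𝓝 P₂, U ∈ 𝓝 (gramEntries R.1) := by
      refine (hgram G₂).continuousAt.eventually (eventually_mem_nhds_iff.2 ?_)
      change U ∈ 𝓝 (gramEntries Q₂)
      rwa [← hs₂]
    have h3 := eventually_map_nhds_gramEntries G₂ P₂ J (by rw [hs₂] at hJ; exact hJ)
    have h4 : ∀ᶠ R : G₂.patternSpace in 𝓝 P₂,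
        (fun R : G₁.patternSpace => π (gramEntries R.1)) '' A G₁ ∈ 𝓝 (π (gramEntries R.1)) := by
      refine (hπ.comp (hgram G₂)).continuousAt.eventually (eventually_mem_nhds_iff.2 ?_)
      change _ ∈ 𝓝 (π (gramEntries Q₂))
      rwa [← hs₂]
    obtain ⟨R, h5, ⟨⟨h6, h7⟩, h8⟩, h9⟩ :=
      ((frequently_diag_ne_zero G₂ P₂).and_eventually (((h1.and h2).and h3).and h4)).exists
    exact ⟨R, h5, h6, h7, h8, h9⟩
  have hA₂ : A G₂ ∈ 𝓝 R :=
    inter_mem (inter_mem (eventually_diag_ne_zero hRdiag) (eventually_det_ne_zero hRdet))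
      ((hgram G₂).continuousAt.preimage_mem_nhds hRU)
  have hB₂ : (fun R : G₂.patternSpace => π (gramEntries R.1)) '' A G₂ ∈
      𝓝 (π (gramEntries R.1)) := hRmap ▸ image_mem_map hA₂
  refine quasiEquiv_of_projection J (O := interior
    (((fun R : G₁.patternSpace => π (gramEntries R.1)) '' A G₁) ∩
      ((fun R : G₂.patternSpace => π (gramEntries R.1)) '' A G₂)))
    isOpen_interior ⟨_, mem_interior_iff_mem_nhds.2 (inter_mem hRB hB₂)⟩ ?_ ?_
  · intro y hy
    obtain ⟨⟨R₁, ⟨⟨hd₁, he₁⟩, hu₁⟩, hy₁⟩, ⟨R₂, ⟨⟨hd₂, he₂⟩, hu₂⟩, hy₂⟩⟩ := interior_subset hy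
    have hd := hdist _ hu₁ _ hu₂ (hzero G₁ hgen₁ R₁) (hzero G₂ hgen₂ R₂)
    have hyy : (fun i : J => gramEntries R₁.1 i) = fun i : J => gramEntries R₂.1 i :=
      hy₁.trans hy₂.symm
    rw [hyy, dist_self, mul_zero] at hd
    have heq := dist_le_zero.1 hd
    refine ⟨gramEntries R₁.1, ⟨Matrix.of R₁.1 * (Matrix.of R₁.1)ᵀ, ⟨?_, ?_⟩, ?_⟩, hy₁⟩
    · exact mem_distSet_iff.2 ⟨_, R₁.2, hd₁, he₁, rfl⟩
    · exact mem_distSet_iff.2 ⟨_, R₂.2, hd₂, he₂, mul_transpose_eq_of_gramEntries_eq heq⟩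
    · rw [symEntries_mul_transpose]
      rfl
  · rintro T' (hT' | hT')
    · exact htr.of_specialization fun F hF => hgen₁ F hF T' hT'
    · exact htr.of_specialization fun F hF => hgen₂ F hF T' hT'

end DG

/-! ### Faithfulness and edge counts -/

namespace DG

variable {p : ℕ}

/-- The graph without edges. -/
def edgeless (p : ℕ) : DG p where
  Adj _ _ := False
  loopless _ h := h

theorem QuasiEquiv.symm {G₁ G₂ : DG p} (h : G₁.QuasiEquiv G₂) : G₂.QuasiEquiv G₁ := by
  rwa [QuasiEquiv, Set.union_comm, Set.inter_comm]

theorem DistEquiv.hardConstraints_eq {G₁ G₂ : DG p} (h : G₁.DistEquiv G₂) :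
    G₁.hardConstraints = G₂.hardConstraints := by
  have h' : G₁.distSet = G₂.distSet := h
  simp only [hardConstraints, IsDistConstraint, h']

theorem mem_hardConstraints_of_ne_zero {G : DG p} {f : MvPolynomial (UpperIndex p) ℚ}
    (hf : f ≠ 0) (h : G.IsDistConstraint f) : f ∈ G.hardConstraints :=
  ⟨h, volume_setOf_aeval_eq_zero hf⟩

theorem satisfies_X {T : Matrix (Fin p) (Fin p) ℝ} {e : UpperIndex p} :
    Satisfies T (MvPolynomial.X e) ↔ T e.1.1 e.1.2 = 0 := by
  simp [Satisfies, symEntries]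

theorem satisfies_mul {T : Matrix (Fin p) (Fin p) ℝ} {f g : MvPolynomial (UpperIndex p) ℚ} :
    Satisfies T (f * g) ↔ Satisfies T f ∨ Satisfies T g := by
  simp [Satisfies]

/-- The distribution set of a graph without edges consists of diagonal matrices. -/
theorem apply_eq_zero_of_mem_distSet {G : DG p} (hG : ∀ i j, ¬ G.Adj i j)
    {T : Matrix (Fin p) (Fin p) ℝ} (hT : T ∈ G.distSet) {i j : Fin p} (hij : i ≠ j) :
    T i j = 0 := by
  obtain ⟨Q, hQ, -, -, rfl⟩ := mem_distSet_iff.1 hT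
  rw [Matrix.mul_apply]
  refine Finset.sum_eq_zero fun l _ => ?_
  rw [Matrix.transpose_apply]
  by_cases hil : i = l
  · rw [hQ j l (fun h => hij (hil.trans h.symm)) (hG _ _), mul_zero]
  · rw [hQ i l hil (hG _ _), zero_mul]

theorem diagonal_mem_distSet (G : DG p) {d : Fin p → ℝ} (hd : ∀ i, 0 < d i) :
    Matrix.diagonal d ∈ G.distSet := by
  have hs : ∀ i, √(d i) ≠ 0 := fun i => (Real.sqrt_pos.2 (hd i)).ne'
  refine mem_distSet_iff.2 ⟨Matrix.diagonal fun i => √(d i),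
    fun i j hij _ => Matrix.diagonal_apply_ne _ hij, fun i => ?_, ?_, ?_⟩
  · simpa using hs i
  · rw [Matrix.det_diagonal]
    exact Finset.prod_ne_zero_iff.2 fun i _ => hs i
  · rw [Matrix.diagonal_transpose, Matrix.diagonal_mul_diagonal]
    congr 1
    ext i
    rw [Real.mul_self_sqrt (hd i).le]

/-- An edge `i → j` produces a precision matrix with nonzero entry `(i, j)`. -/
theorem exists_mem_distSet_apply_ne_zero {G : DG p} {i j : Fin p} (h : G.Adj i j) :
    ∃ T ∈ G.distSet, T i j ≠ 0 := by
  have hij : i ≠ j := fun hij => G.loopless j (hij ▸ h)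
  have hoff : ∀ k l, Matrix.transvection i j (1 : ℝ) k l =
      (if k = l then 1 else 0) + if i = k ∧ j = l then 1 else 0 := by
    intro k l
    simp [Matrix.transvection, Matrix.one_apply, Matrix.single_apply]
  refine ⟨_, mem_distSet_iff.2 ⟨Matrix.transvection i j (1 : ℝ), ?_, ?_, ?_, rfl⟩, ?_⟩
  · intro k l hkl hadj
    rw [hoff, if_neg hkl, zero_add, if_neg]
    rintro ⟨rfl, rfl⟩
    exact hadj h
  · intro k
    rw [hoff, if_pos rfl, if_neg]
    · simp
    · rintro ⟨rfl, rfl⟩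
      exact hij rfl
  · rw [Matrix.det_transvection_of_ne _ _ hij]
    exact one_ne_zero
  · rw [Matrix.mul_apply, Finset.sum_eq_single j]
    · simp [hoff, hij]
    · intro l _ hl
      rw [Matrix.transpose_apply, hoff j l, if_neg (Ne.symm hl), if_neg (fun h => hij h.1)]
      simp
    · simp

theorem not_adj_of_numEdges_eq_zero {G : DG p} (h : G.numEdges = 0) (i j : Fin p) :
    ¬ G.Adj i j := by
  intro hadj
  rw [numEdges, Set.ncard_eq_zero] at h
  exact Set.notMem_empty (i, j) (h ▸ (show (i, j) ∈ G.edgeSet from hadj))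

/-- Graphs that generate only diagonal precision matrices generate all positive ones. -/
theorem quasiEquiv_of_diagonal {G₁ G₂ : DG p}
    (h₁ : ∀ T ∈ G₁.distSet, ∀ e : UpperIndex p, e.1.1 ≠ e.1.2 → T e.1.1 e.1.2 = 0)
    (h₂ : ∀ T ∈ G₂.distSet, ∀ e : UpperIndex p, e.1.1 ≠ e.1.2 → T e.1.1 e.1.2 = 0) :
    G₁.QuasiEquiv G₂ := by
  classical
  let J : Finset (UpperIndex p) := Finset.univ.filter fun e => e.1.1 = e.1.2
  have hJ : ∀ {e : UpperIndex p}, e ∈ J ↔ e.1.1 = e.1.2 := by simp [J]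
  refine quasiEquiv_of_projection J (O := Set.univ.pi fun _ => Set.Ioi 0)
    (isOpen_set_pi Set.finite_univ fun _ _ => isOpen_Ioi)
    (Set.univ_pi_nonempty_iff.2 fun _ => ⟨1, Set.mem_Ioi.2 one_pos⟩) ?_ ?_
  · intro y hy
    let d : Fin p → ℝ := fun i => y ⟨⟨(i, i), le_rfl⟩, hJ.2 rfl⟩
    have hd : ∀ i, 0 < d i := fun i => hy _ trivial
    refine ⟨_, ⟨Matrix.diagonal d, ⟨G₁.diagonal_mem_distSet hd, G₂.diagonal_mem_distSet hd⟩,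
      rfl⟩, ?_⟩
    ext ⟨⟨⟨i, j⟩, hij⟩, he⟩
    obtain rfl : i = j := hJ.1 he
    simp [symEntries, d]
  · intro T hT J' hJ'
    refine Finset.card_le_card fun e he => ?_
    rw [hJ]
    by_contra hne
    have h0 : symEntries T e = 0 := by
      rcases hT with hT | hT
      · exact h₁ T hT e hne
      · exact h₂ T hT e hne
    exact hJ'.ne_zero ⟨e, he⟩ h0

/-- If `T ∈ Θ(G)` is faithful to `G` and not diagonal, then `T` is a generic point of `Θ(G)`: a
polynomial `f` that vanishes at `T` vanishes on `Θ(G)`. Indeed, if `T i j ≠ 0` with `i ≠ j`, then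
`f * Θ i j` is a hard constraint of the graph without edges. -/
theorem isDistConstraint_of_gFaithful {G : DG p} {T : Matrix (Fin p) (Fin p) ℝ}
    (hT : T ∈ G.distSet) (hfaith : GFaithful T G) {e : UpperIndex p} (he : e.1.1 ≠ e.1.2)
    (hTe : T e.1.1 e.1.2 ≠ 0) {f : MvPolynomial (UpperIndex p) ℚ} (hf : Satisfies T f) :
    G.IsDistConstraint f := by
  rcases eq_or_ne f 0 with rfl | hf0
  · intro T' _
    simp [Satisfies]
  have hhard : IsHardConstraint (f * MvPolynomial.X e) :=
    ⟨edgeless p, mem_hardConstraints_of_ne_zero (mul_ne_zero hf0 (MvPolynomial.X_ne_zero e))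
      fun T' hT' => satisfies_mul.2 (Or.inr (satisfies_X.2
        (apply_eq_zero_of_mem_distSet (fun _ _ h => h) hT' he)))⟩
  have hmem := (hfaith _ hhard).1 (satisfies_mul.2 (Or.inl hf))
  exact hmem.1.of_mul hT (fun h => hTe (satisfies_X.1 h))

/-- A graph that has `T` as a limit of its distributions, and no more edges than the minimal graph
`Gdag`, is quasi-equivalent to the graph `G` to which `T` is faithful. -/
theorem quasiEquiv_of_gFaithful {G Gdag Ghat : DG p} {T Q : Matrix (Fin p) (Fin p) ℝ}
    (hT : T ∈ G.distSet) (hfaith : GFaithful T G) (hequiv : Gdag.DistEquiv G)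
    (hmin : Gdag.MinimalEdges) (hQ : Q ∈ Ghat.patternSpace) (hTQ : T = Q * Qᵀ)
    (hcard : Ghat.numEdges ≤ Gdag.numEdges) : Ghat.QuasiEquiv G := by
  have hsub : Ghat.hardConstraints ⊆ Gdag.hardConstraints := by
    intro κ hκ
    rw [hequiv.hardConstraints_eq]
    refine (hfaith κ ⟨Ghat, hκ⟩).1 ?_
    rw [hTQ]
    exact hκ.1.satisfies_mul_transpose hQ
  have hH : Ghat.hardConstraints = G.hardConstraints :=
    (hmin Ghat hsub hcard).trans hequiv.hardConstraints_eq
  by_cases hdiag : ∀ e : UpperIndex p, e.1.1 ≠ e.1.2 → T e.1.1 e.1.2 = 0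
  · have hGdiag : ∀ T' ∈ G.distSet, ∀ e : UpperIndex p, e.1.1 ≠ e.1.2 →
        T' e.1.1 e.1.2 = 0 := by
      intro T' hT' e he
      have hhard : IsHardConstraint (MvPolynomial.X e : MvPolynomial (UpperIndex p) ℚ) :=
        ⟨edgeless p, mem_hardConstraints_of_ne_zero (MvPolynomial.X_ne_zero e)
          fun T' hT' => satisfies_X.2 (apply_eq_zero_of_mem_distSet (fun _ _ h => h) hT' he)⟩
      exact satisfies_X.1 (((hfaith _ hhard).1 (satisfies_X.2 (hdiag e he))).1 T' hT')
    have hdag : ∀ i j, ¬ Gdag.Adj i j := by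
      intro i j hadj
      have hij : i ≠ j := fun hij => Gdag.loopless j (hij ▸ hadj)
      obtain ⟨T', hT', hne⟩ := exists_mem_distSet_apply_ne_zero hadj
      have hT'' : T' ∈ G.distSet := by
        have h' : Gdag.distSet = G.distSet := hequiv
        rwa [← h']
      rcases le_total i j with h | h
      · exact hne (hGdiag T' hT'' ⟨(i, j), h⟩ hij)
      · obtain ⟨R, -, -, -, rfl⟩ := mem_distSet_iff.1 hT''
        have hsymm : (R * Rᵀ) i j = (R * Rᵀ) j i := by
          simp [Matrix.mul_apply, mul_comm]
        rw [hsymm] at hne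
        exact hne (hGdiag _ hT'' ⟨(j, i), h⟩ hij.symm)
    have hzero : Gdag.numEdges = 0 := by
      rw [numEdges, Set.ncard_eq_zero, Set.eq_empty_iff_forall_notMem]
      exact fun e he => hdag _ _ he
    exact quasiEquiv_of_diagonal (fun T' hT' e he => apply_eq_zero_of_mem_distSet
      (not_adj_of_numEdges_eq_zero (by omega)) hT' he) hGdiag
  · push Not at hdiag
    obtain ⟨e, he, hTe⟩ := hdiag
    have hgen : ∀ f, Satisfies T f → G.IsDistConstraint f := fun f hf =>
      isDistConstraint_of_gFaithful hT hfaith he hTe hf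
    refine (quasiEquiv_of_generic hT hQ hTQ hgen fun f hf => ?_).symm
    rcases eq_or_ne f 0 with rfl | hf0
    · intro T' _
      simp [Satisfies]
    have hmem := mem_hardConstraints_of_ne_zero hf0 (hgen f hf)
    rw [← hH] at hmem
    exact hmem.1

end DG

/-! ### The Gaussian loss near the identity -/

/-- The squared Frobenius distance of `M` to the identity matrix. -/
def sqDistOne {p : ℕ} (M : Matrix (Fin p) (Fin p) ℝ) : ℝ :=
  ∑ i, ∑ j, (M i j - (1 : Matrix (Fin p) (Fin p) ℝ) i j) ^ 2

/-- Twice the negative Gaussian log-likelihood per sample, as a function of a square root `T` of the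
precision matrix and of the second moment matrix `M`. -/
noncomputable def gaussLoss {p : ℕ} (M T : Matrix (Fin p) (Fin p) ℝ) : ℝ :=
  -Real.log (T.det ^ 2) + (Tᵀ * M * T).trace

theorem Matrix.IsHermitian.sqDistOne_eq_sum_eigenvalues {p : ℕ} {M : Matrix (Fin p) (Fin p) ℝ}
    (hM : M.IsHermitian) : sqDistOne M = ∑ i, (hM.eigenvalues i - 1) ^ 2 := by
  set φ := (Unitary.conjStarAlgAut ℝ (Matrix (Fin p) (Fin p) ℝ)) hM.eigenvectorUnitary with hφ
  set D : Matrix (Fin p) (Fin p) ℝ := Matrix.diagonal (RCLike.ofReal ∘ hM.eigenvalues) with hD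
  have hMD : M = φ D := hM.spectral_theorem
  have htr : ∀ X, (φ X).trace = X.trace := by
    intro X
    rw [hφ, Unitary.conjStarAlgAut_apply, Matrix.trace_mul_cycle]
    simp
  have h1 : (M - 1) * (M - 1) = φ ((D - 1) * (D - 1)) := by
    rw [map_mul, map_sub, map_one, ← hMD]
  have h2 : ((M - 1) * (M - 1)).trace = sqDistOne M := by
    have hs : ∀ i j, M i j = M j i := fun i j => by
      simpa using (hM.apply i j).symm
    simp only [Matrix.trace, Matrix.diag_apply, Matrix.mul_apply, Matrix.sub_apply, sqDistOne]
    refine Finset.sum_congr rfl fun i _ => Finset.sum_congr rfl fun j _ => ?_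
    rw [hs j i, Matrix.one_apply, Matrix.one_apply]
    simp only [eq_comm (a := j)]
    ring
  have h3 : (D - 1) * (D - 1) = Matrix.diagonal fun i => (hM.eigenvalues i - 1) ^ 2 := by
    rw [hD, ← Matrix.diagonal_one, Matrix.diagonal_sub, Matrix.diagonal_mul_diagonal]
    congr 1
    ext i
    simp [sq]
  rw [← h2, h1, htr, h3, Matrix.trace_diagonal]

theorem Matrix.PosDef.log_det_eq_sum {p : ℕ} {M : Matrix (Fin p) (Fin p) ℝ} (hM : M.PosDef) :
    Real.log M.det = ∑ i, Real.log (hM.isHermitian.eigenvalues i) := by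
  rw [hM.isHermitian.det_eq_prod_eigenvalues]
  exact Real.log_prod fun i _ => (hM.eigenvalues_pos i).ne'

theorem Matrix.PosDef.trace_sub_log_det_eq_sum {p : ℕ} {M : Matrix (Fin p) (Fin p) ℝ}
    (hM : M.PosDef) : M.trace - Real.log M.det =
      ∑ i, (hM.isHermitian.eigenvalues i - Real.log (hM.isHermitian.eigenvalues i)) := by
  rw [hM.log_det_eq_sum, hM.isHermitian.trace_eq_sum_eigenvalues, Finset.sum_sub_distrib]
  rfl

theorem Matrix.PosDef.le_trace_sub_log_det {p : ℕ} {M : Matrix (Fin p) (Fin p) ℝ}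
    (hM : M.PosDef) : (p : ℝ) ≤ M.trace - Real.log M.det := by
  rw [hM.trace_sub_log_det_eq_sum]
  calc (p : ℝ) = ∑ _i : Fin p, (1 : ℝ) := by simp
    _ ≤ _ := Finset.sum_le_sum fun i _ => by
      linarith [Real.log_le_sub_one_of_pos (hM.eigenvalues_pos i)]

theorem eq_one_of_sqDistOne_eq_zero {p : ℕ} {M : Matrix (Fin p) (Fin p) ℝ}
    (h : sqDistOne M = 0) : M = 1 := by
  ext i j
  have h1 := (Finset.sum_eq_zero_iff_of_nonneg fun i _ =>
    Finset.sum_nonneg fun j _ => sq_nonneg _).1 h i (Finset.mem_univ i)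
  have h2 := (Finset.sum_eq_zero_iff_of_nonneg fun j _ => sq_nonneg _).1 h1 j (Finset.mem_univ j)
  exact sub_eq_zero.1 (pow_eq_zero_iff two_ne_zero |>.1 h2)

/-- The identity is the only minimizer of `tr M - log det M`, by strictness of `log x < x - 1`. -/
theorem Matrix.PosDef.eq_one_of_trace_sub_log_det_le {p : ℕ} {M : Matrix (Fin p) (Fin p) ℝ}
    (hM : M.PosDef) (h : M.trace - Real.log M.det ≤ p) : M = 1 := by
  refine eq_one_of_sqDistOne_eq_zero ?_
  rw [hM.isHermitian.sqDistOne_eq_sum_eigenvalues]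
  refine Finset.sum_eq_zero fun i _ => ?_
  by_contra hne
  have hne1 : hM.isHermitian.eigenvalues i ≠ 1 := fun h1 => hne (by rw [h1]; norm_num)
  have hlt : ∑ _i : Fin p, (1 : ℝ) <
      ∑ i, (hM.isHermitian.eigenvalues i - Real.log (hM.isHermitian.eigenvalues i)) := by
    refine Finset.sum_lt_sum (fun j _ => ?_) ⟨i, Finset.mem_univ i, ?_⟩
    · linarith [Real.log_le_sub_one_of_pos (hM.eigenvalues_pos j)]
    · linarith [Real.log_lt_sub_one_of_pos (hM.eigenvalues_pos i) hne1]
  rw [← hM.trace_sub_log_det_eq_sum] at hlt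
  simp at hlt
  linarith

/-- Close to the identity, the Gaussian loss exceeds its minimum by a quadratic term at most. -/
theorem Matrix.PosDef.trace_sub_log_det_le {p : ℕ} {M : Matrix (Fin p) (Fin p) ℝ}
    (hM : M.PosDef) (h : sqDistOne M ≤ 1 / 4) :
    M.trace - Real.log M.det ≤ p + 2 * sqDistOne M := by
  rw [hM.trace_sub_log_det_eq_sum]
  have heq := hM.isHermitian.sqDistOne_eq_sum_eigenvalues
  have hterm : ∀ i, hM.isHermitian.eigenvalues i - Real.log (hM.isHermitian.eigenvalues i) ≤
      1 + 2 * (hM.isHermitian.eigenvalues i - 1) ^ 2 := by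
    intro i
    set l := hM.isHermitian.eigenvalues i with hl
    have h1 : (l - 1) ^ 2 ≤ 1 / 4 := by
      refine le_trans ?_ h
      rw [heq]
      exact Finset.single_le_sum (f := fun i => (hM.isHermitian.eigenvalues i - 1) ^ 2)
        (fun _ _ => sq_nonneg _) (Finset.mem_univ i)
    have h2 : 1 / 2 ≤ l := by nlinarith
    have hpos : 0 < l := by linarith
    have h3 := Real.one_sub_inv_le_log_of_pos hpos
    have h4 : l - 1 - (1 - l⁻¹) = (l - 1) ^ 2 / l := by
      field_simp
    have h5 : (l - 1) ^ 2 / l ≤ 2 * (l - 1) ^ 2 := by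
      rw [div_le_iff₀ hpos]
      nlinarith [sq_nonneg (l - 1)]
    linarith
  calc _ ≤ ∑ i, (1 + 2 * (hM.isHermitian.eigenvalues i - 1) ^ 2) :=
        Finset.sum_le_sum fun i _ => hterm i
    _ = _ := by rw [Finset.sum_add_distrib, ← Finset.mul_sum, ← heq]; simp

/-- A matrix close to the identity is bounded below by half the identity. -/
theorem half_sum_sq_le_of_sqDistOne_le {p : ℕ} {M : Matrix (Fin p) (Fin p) ℝ}
    (h : sqDistOne M ≤ 1 / 4) (x : Fin p → ℝ) :
    1 / 2 * ∑ i, x i ^ 2 ≤ x ⬝ᵥ M *ᵥ x := by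
  set N := ∑ i, x i ^ 2 with hN
  have hN0 : 0 ≤ N := Finset.sum_nonneg fun _ _ => sq_nonneg _
  have hexp : x ⬝ᵥ M *ᵥ x = N + ∑ i, ∑ j,
      (M i j - (1 : Matrix (Fin p) (Fin p) ℝ) i j) * (x i * x j) := by
    simp only [dotProduct, Matrix.mulVec, Finset.mul_sum, sub_mul, Finset.sum_sub_distrib]
    have : ∑ i, ∑ j, (1 : Matrix (Fin p) (Fin p) ℝ) i j * (x i * x j) = N := by
      simp [Matrix.one_apply, hN, sq]
    rw [this, add_sub_cancel]
    exact Finset.sum_congr rfl fun i _ => Finset.sum_congr rfl fun j _ => by ring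
  rcases hN0.eq_or_lt with h0 | hpos
  · have hx : ∀ i, x i = 0 := fun i => by
      have := (Finset.sum_eq_zero_iff_of_nonneg fun i _ => sq_nonneg (x i)).1 h0.symm i
        (Finset.mem_univ i)
      exact pow_eq_zero_iff two_ne_zero |>.1 this
    rw [hexp, ← h0]
    simp [hx]
  · have hterm : ∀ i j, -(N * (M i j - (1 : Matrix (Fin p) (Fin p) ℝ) i j) ^ 2 +
        (x i ^ 2 * x j ^ 2) * (4 * N)⁻¹) ≤
        (M i j - (1 : Matrix (Fin p) (Fin p) ℝ) i j) * (x i * x j) := by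
      intro i j
      set a := M i j - (1 : Matrix (Fin p) (Fin p) ℝ) i j
      have h1 : N * a ^ 2 + (x i ^ 2 * x j ^ 2) * (4 * N)⁻¹ + a * (x i * x j) =
          N * (a + x i * x j / (2 * N)) ^ 2 := by
        field_simp
        ring
      have h2 : 0 ≤ N * (a + x i * x j / (2 * N)) ^ 2 := by positivity
      linarith
    have hsum := Finset.sum_le_sum fun i (_ : i ∈ Finset.univ) =>
      Finset.sum_le_sum fun j (_ : j ∈ Finset.univ) => hterm i j
    have hleft : ∑ i, ∑ j, -(N * (M i j - (1 : Matrix (Fin p) (Fin p) ℝ) i j) ^ 2 +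
        (x i ^ 2 * x j ^ 2) * (4 * N)⁻¹) = -(N * sqDistOne M + N * N * (4 * N)⁻¹) := by
      have hNN : N * N = ∑ i, ∑ j, x i ^ 2 * x j ^ 2 := by
        rw [hN, Finset.sum_mul_sum]
      rw [hNN, sqDistOne]
      simp only [Finset.sum_neg_distrib, Finset.sum_add_distrib, Finset.mul_sum, Finset.sum_mul]
    rw [hleft] at hsum
    have h3 : N * N * (4 * N)⁻¹ = N / 4 := by
      field_simp
    rw [hexp]
    nlinarith

theorem posDef_of_sqDistOne_le {p : ℕ} {M : Matrix (Fin p) (Fin p) ℝ} (hM : M.IsHermitian)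
    (h : sqDistOne M ≤ 1 / 4) : M.PosDef := by
  refine Matrix.PosDef.of_dotProduct_mulVec_pos hM fun x hx => ?_
  rw [star_trivial]
  refine lt_of_lt_of_le ?_ (half_sum_sq_le_of_sqDistOne_le h x)
  obtain ⟨i, hi⟩ := Function.ne_iff.1 hx
  have : 0 < ∑ i, x i ^ 2 :=
    Finset.sum_pos' (fun _ _ => sq_nonneg _) ⟨i, Finset.mem_univ i, by
      have : x i ≠ 0 := hi
      positivity⟩
  linarith

theorem half_trace_le_of_sqDistOne_le {p : ℕ} {M : Matrix (Fin p) (Fin p) ℝ}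
    (h : sqDistOne M ≤ 1 / 4) (T : Matrix (Fin p) (Fin p) ℝ) :
    1 / 2 * (Tᵀ * T).trace ≤ (Tᵀ * M * T).trace := by
  simp only [Matrix.trace, Finset.mul_sum, Matrix.diag_apply]
  refine Finset.sum_le_sum fun k _ => ?_
  have h1 := half_sum_sq_le_of_sqDistOne_le h (fun i => T i k)
  have h2 : (Tᵀ * M * T) k k = (fun i => T i k) ⬝ᵥ M *ᵥ (fun i => T i k) := by
    rw [Matrix.mul_assoc, Matrix.mul_apply]
    rfl
  have h3 : (Tᵀ * T) k k = ∑ i, T i k ^ 2 := by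
    simp [Matrix.mul_apply, sq]
  rw [h2, h3]
  exact h1

theorem injective_mulVec_of_det_ne_zero {p : ℕ} {T : Matrix (Fin p) (Fin p) ℝ} (h : T.det ≠ 0) :
    Function.Injective T.mulVec :=
  Matrix.mulVec_injective_iff_isUnit.2 ((Matrix.isUnit_iff_isUnit_det T).2 (isUnit_iff_ne_zero.2 h))

/-- The unconstrained minimum of the Gaussian loss. -/
theorem le_gaussLoss {p : ℕ} {M T : Matrix (Fin p) (Fin p) ℝ} (hM : M.PosDef) (hT : T.det ≠ 0) :
    p + Real.log M.det ≤ gaussLoss M T := by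
  have h1 : (Tᵀ * M * T).PosDef := by
    have := hM.conjTranspose_mul_mul_same (injective_mulVec_of_det_ne_zero hT)
    rwa [Matrix.conjTranspose_eq_transpose_of_trivial] at this
  have h2 := h1.le_trace_sub_log_det
  have h3 : (Tᵀ * M * T).det = M.det * T.det ^ 2 := by
    rw [Matrix.det_mul, Matrix.det_mul, Matrix.det_transpose]
    ring
  rw [h3, Real.log_mul hM.det_pos.ne' (pow_ne_zero 2 hT)] at h2
  rw [gaussLoss]
  linarith

theorem posDef_transpose_mul_self {p : ℕ} {T : Matrix (Fin p) (Fin p) ℝ} (hT : T.det ≠ 0) :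
    (Tᵀ * T).PosDef := by
  have := Matrix.PosDef.conjTranspose_mul_self T (injective_mulVec_of_det_ne_zero hT)
  rwa [Matrix.conjTranspose_eq_transpose_of_trivial] at this

/-- The Gaussian loss is coercive. -/
theorem quarter_trace_le_gaussLoss {p : ℕ} {M T : Matrix (Fin p) (Fin p) ℝ}
    (h : sqDistOne M ≤ 1 / 4) (hT : T.det ≠ 0) :
    1 / 4 * (Tᵀ * T).trace + (p - p * Real.log 4) ≤ gaussLoss M T := by
  have h1 := half_trace_le_of_sqDistOne_le h T
  have h2 := ((posDef_transpose_mul_self hT).smul (a := (1 / 4 : ℝ))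
    (by norm_num)).le_trace_sub_log_det
  have h3 : ((1 / 4 : ℝ) • (Tᵀ * T)).det = (1 / 4) ^ p * T.det ^ 2 := by
    rw [Matrix.det_smul, Matrix.det_mul, Matrix.det_transpose, Fintype.card_fin]
    ring
  rw [h3, Real.log_mul (by positivity) (pow_ne_zero 2 hT), Real.log_pow, Matrix.trace_smul,
    one_div, Real.log_inv, smul_eq_mul] at h2
  rw [gaussLoss]
  linarith

theorem neg_log_det_sq_le_gaussLoss {p : ℕ} {M T : Matrix (Fin p) (Fin p) ℝ}
    (h : sqDistOne M ≤ 1 / 4) : -Real.log (T.det ^ 2) ≤ gaussLoss M T := by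
  have h1 := half_trace_le_of_sqDistOne_le h T
  have h2 : 0 ≤ (Tᵀ * T).trace := by
    simp only [Matrix.trace, Matrix.diag_apply, Matrix.mul_apply, Matrix.transpose_apply]
    exact Finset.sum_nonneg fun _ _ => Finset.sum_nonneg fun _ _ => mul_self_nonneg _
  rw [gaussLoss]
  linarith

/-! ### Minimizers of the Gaussian loss -/

theorem isCompact_setOf_trace_le_det_ge (p : ℕ) (R c : ℝ) :
    IsCompact {T : Matrix (Fin p) (Fin p) ℝ | (Tᵀ * T).trace ≤ R ∧ c ≤ T.det ^ 2} := by
  have hbox : IsCompact (Set.univ.pi fun _ : Fin p => Set.univ.pi fun _ : Fin p =>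
      Set.Icc (-(R + 1)) (R + 1)) :=
    isCompact_univ_pi fun _ => isCompact_univ_pi fun _ => isCompact_Icc
  refine IsCompact.of_isClosed_subset (X := Fin p → Fin p → ℝ) hbox ?_ ?_
  · have h1 : Continuous fun T : Matrix (Fin p) (Fin p) ℝ => (Tᵀ * T).trace := by fun_prop
    have h2 : Continuous fun T : Matrix (Fin p) (Fin p) ℝ => T.det ^ 2 := by fun_prop
    exact (isClosed_le h1 continuous_const).inter (isClosed_le continuous_const h2)
  · rintro T ⟨hT, -⟩ i - j -
    have h1 : T i j ^ 2 ≤ R := by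
      refine le_trans ?_ hT
      simp only [Matrix.trace, Matrix.diag_apply]
      have h2 : T i j * T i j ≤ ∑ k, T k j * T k j :=
        Finset.single_le_sum (f := fun k => T k j * T k j) (fun _ _ => mul_self_nonneg _)
          (Finset.mem_univ i)
      have h3 : ∑ k, T k j * T k j ≤ ∑ j, ∑ k, T k j * T k j :=
        Finset.single_le_sum (f := fun j => ∑ k, T k j * T k j)
          (fun _ _ => Finset.sum_nonneg fun _ _ => mul_self_nonneg _) (Finset.mem_univ j)
      rw [sq]
      exact h2.trans h3
    constructor <;> nlinarith [sq_nonneg (T i j - 1), sq_nonneg (T i j + 1)]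

theorem continuousAt_gaussLoss {p : ℕ} {M T : Matrix (Fin p) (Fin p) ℝ} (hT : T.det ≠ 0) :
    ContinuousAt (fun x : Matrix (Fin p) (Fin p) ℝ × Matrix (Fin p) (Fin p) ℝ =>
      gaussLoss x.1 x.2) (M, T) := by
  unfold gaussLoss
  have h1 : Continuous fun x : Matrix (Fin p) (Fin p) ℝ × Matrix (Fin p) (Fin p) ℝ =>
      x.2.det ^ 2 := by fun_prop
  have h2 : Continuous fun x : Matrix (Fin p) (Fin p) ℝ × Matrix (Fin p) (Fin p) ℝ =>
      (x.2ᵀ * x.1 * x.2).trace := by fun_prop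
  exact ((h1.continuousAt.log (pow_ne_zero 2 hT)).neg).add h2.continuousAt

/-- Sublevel sets of the Gaussian loss, uniformly in the second moment matrix, lie in a compact set
of invertible matrices. -/
theorem exists_compact_of_gaussLoss_le (p : ℕ) (a : ℝ) :
    ∃ R c : ℝ, 0 < c ∧ ∀ M T : Matrix (Fin p) (Fin p) ℝ, sqDistOne M ≤ 1 / 4 → T.det ≠ 0 →
      gaussLoss M T ≤ a → (Tᵀ * T).trace ≤ R ∧ c ≤ T.det ^ 2 := by
  refine ⟨4 * (a - (p - p * Real.log 4)), Real.exp (-a), Real.exp_pos _,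
    fun M T hM hT ha => ⟨?_, ?_⟩⟩
  · linarith [quarter_trace_le_gaussLoss hM hT]
  · rw [← Real.le_log_iff_exp_le (by positivity)]
    linarith [neg_log_det_sq_le_gaussLoss (T := T) hM]

/-- The Gaussian loss attains its minimum on the invertible matrices of a closed set. -/
theorem exists_minimizer_gaussLoss {p : ℕ} {M : Matrix (Fin p) (Fin p) ℝ}
    (hM : sqDistOne M ≤ 1 / 4) {W : Set (Matrix (Fin p) (Fin p) ℝ)} (hW : IsClosed W)
    {T₀ : Matrix (Fin p) (Fin p) ℝ} (hT₀ : T₀ ∈ W) (hdet : T₀.det ≠ 0) :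
    ∃ T ∈ W, T.det ≠ 0 ∧ ∀ T' ∈ W, T'.det ≠ 0 → gaussLoss M T ≤ gaussLoss M T' := by
  obtain ⟨R, c, hc, hRc⟩ := exists_compact_of_gaussLoss_le p (gaussLoss M T₀)
  have hK := (isCompact_setOf_trace_le_det_ge p R c).inter_right hW
  have hne : ∀ T : Matrix (Fin p) (Fin p) ℝ, c ≤ T.det ^ 2 → T.det ≠ 0 := by
    intro T hT h0
    rw [h0] at hT
    norm_num at hT
    linarith
  obtain ⟨T, ⟨⟨-, hTc⟩, hTW⟩, hmin⟩ := hK.exists_isMinOn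
    (f := fun T => gaussLoss M T) ⟨T₀, hRc M T₀ hM hdet le_rfl, hT₀⟩ fun T hT =>
      ((continuousAt_gaussLoss (M := M) (hne T hT.1.2)).comp
        (f := fun T => (M, T)) (by fun_prop)).continuousWithinAt
  refine ⟨T, hTW, hne T hTc, fun T' hT' hdet' => ?_⟩
  rcases le_total (gaussLoss M T') (gaussLoss M T₀) with h | h
  · exact hmin ⟨hRc M T' hM hdet' h, hT'⟩
  · exact (hmin ⟨hRc M T₀ hM hdet le_rfl, hT₀⟩ : gaussLoss M T ≤ gaussLoss M T₀).trans h

theorem mul_transpose_eq_one_of_gaussLoss_one_le {p : ℕ} {T : Matrix (Fin p) (Fin p) ℝ}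
    (hT : T.det ≠ 0) (h : gaussLoss 1 T ≤ p) : T * Tᵀ = 1 := by
  refine mul_eq_one_comm.1 ((posDef_transpose_mul_self hT).eq_one_of_trace_sub_log_det_le ?_)
  rw [gaussLoss, Matrix.mul_one] at h
  rw [Matrix.det_mul, Matrix.det_transpose, ← sq]
  linarith

theorem tendsto_one_of_sqDistOne_le {p : ℕ} {M : ℕ → Matrix (Fin p) (Fin p) ℝ} {b : ℕ → ℝ}
    (hM : ∀ m, sqDistOne (M m) ≤ b m) (hb : Tendsto b atTop (𝓝 0)) :
    Tendsto M atTop (𝓝 1) := by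
  refine tendsto_pi_nhds.2 fun i => tendsto_pi_nhds.2 fun j => ?_
  have hsq : Tendsto (fun m => (M m i j - (1 : Matrix (Fin p) (Fin p) ℝ) i j) ^ 2) atTop
      (𝓝 0) := by
    refine squeeze_zero (fun _ => sq_nonneg _) (fun m => ?_) hb
    refine le_trans ?_ (hM m)
    have h2 := Finset.single_le_sum
      (f := fun j => (M m i j - (1 : Matrix (Fin p) (Fin p) ℝ) i j) ^ 2)
      (fun _ _ => sq_nonneg _) (Finset.mem_univ j)
    exact h2.trans (Finset.single_le_sum
      (f := fun i => ∑ j, (M m i j - (1 : Matrix (Fin p) (Fin p) ℝ) i j) ^ 2)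
      (fun _ _ => Finset.sum_nonneg fun _ _ => sq_nonneg _) (Finset.mem_univ i))
  have habs := hsq.sqrt
  simp only [Real.sqrt_sq_eq_abs, Real.sqrt_zero] at habs
  exact tendsto_sub_nhds_zero_iff.1 ((tendsto_zero_iff_abs_tendsto_zero _).2 habs)

/-- If a closed set of matrices contains no orthogonal matrix, then its Gaussian loss stays away
from the unconstrained minimum, uniformly for second moment matrices near the identity. -/
theorem exists_gap_gaussLoss {p : ℕ} {W : Set (Matrix (Fin p) (Fin p) ℝ)} (hW : IsClosed W)
    (hno : ∀ T ∈ W, T * Tᵀ ≠ 1) :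
    ∃ ε > 0, ∀ M, sqDistOne M ≤ ε → ∀ T ∈ W, T.det ≠ 0 → p + ε ≤ gaussLoss M T := by
  by_contra! hcon
  have hpos : ∀ m : ℕ, (0 : ℝ) < 1 / 4 * (1 / ((m : ℝ) + 1)) := fun m => by positivity
  choose M hM T hTW hTdet hlt using fun m : ℕ => hcon _ (hpos m)
  have hle : ∀ m : ℕ, (1 / 4 * (1 / ((m : ℝ) + 1))) ≤ 1 / 4 := fun m => by
    have : 1 / ((m : ℝ) + 1) ≤ 1 := by
      rw [div_le_one (by positivity)]
      linarith [Nat.cast_nonneg (α := ℝ) m]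
    linarith
  have hlim : Tendsto (fun m : ℕ => (1 / 4 * (1 / ((m : ℝ) + 1)))) atTop (𝓝 0) := by
    simpa using tendsto_one_div_add_atTop_nhds_zero_nat.const_mul (1 / 4 : ℝ)
  obtain ⟨R, c, hc, hRc⟩ := exists_compact_of_gaussLoss_le p (p + 1 / 4)
  have : FirstCountableTopology (Matrix (Fin p) (Fin p) ℝ) :=
    inferInstanceAs (FirstCountableTopology (Fin p → Fin p → ℝ))
  obtain ⟨T', ⟨⟨-, hTc⟩, hT'W⟩, φ, hφ, hφT⟩ :=
    ((isCompact_setOf_trace_le_det_ge p R c).inter_right hW).isSeqCompact (x := T) fun m =>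
      ⟨hRc (M m) (T m) ((hM m).trans (hle m)) (hTdet m)
        ((hlt m).le.trans (by linarith [hle m])), hTW m⟩
  have hdet' : T'.det ≠ 0 := by
    intro h0
    rw [h0] at hTc
    norm_num at hTc
    linarith
  have hM1 : Tendsto M atTop (𝓝 1) := tendsto_one_of_sqDistOne_le hM hlim
  have hloss : Tendsto (fun m => gaussLoss (M (φ m)) (T (φ m))) atTop (𝓝 (gaussLoss 1 T')) :=
    Tendsto.comp (f := fun m => (M (φ m), T (φ m))) (continuousAt_gaussLoss (M := 1) hdet').tendsto
      ((hM1.comp hφ.tendsto_atTop).prodMk_nhds hφT)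
  have hbound : gaussLoss 1 T' ≤ p := by
    refine le_of_tendsto_of_tendsto' hloss
      (g := fun m => (p : ℝ) + (1 / 4 * (1 / ((φ m : ℝ) + 1)))) ?_ fun m => (hlt (φ m)).le
    simpa using (hlim.comp hφ.tendsto_atTop).const_add (p : ℝ)
  exact hno T' hT'W (mul_transpose_eq_one_of_gaussLoss_one_le hdet' hbound)

/-! ### The penalized score -/

/-- The matrix of empirical second moments of the rows of `X`. -/
noncomputable def secondMoment {n p : ℕ} (X : Matrix (Fin n) (Fin p) ℝ) :
    Matrix (Fin p) (Fin p) ℝ :=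
  (n : ℝ)⁻¹ • (Xᵀ * X)

/-- The Gaussian loss depends on the square root of the precision matrix only through the precision
matrix. -/
theorem gaussLoss_congr {p : ℕ} {S Q R : Matrix (Fin p) (Fin p) ℝ} (h : Q * Qᵀ = R * Rᵀ) :
    gaussLoss S Q = gaussLoss S R := by
  have key : ∀ Q : Matrix (Fin p) (Fin p) ℝ,
      gaussLoss S Q = -Real.log (Q * Qᵀ).det + (S * (Q * Qᵀ)).trace := by
    intro Q
    rw [gaussLoss, Matrix.det_mul, Matrix.det_transpose, ← sq, Matrix.trace_mul_cycle,
      Matrix.trace_mul_comm]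
  rw [key, key, h]

/-- Change of coordinates by `Q`. -/
theorem gaussLoss_mul {p : ℕ} {S Q T : Matrix (Fin p) (Fin p) ℝ} (hQ : Q.det ≠ 0)
    (hT : T.det ≠ 0) :
    gaussLoss S (Q * T) = gaussLoss (Qᵀ * S * Q) T - Real.log (Q.det ^ 2) := by
  rw [gaussLoss, gaussLoss, Matrix.det_mul, mul_pow,
    Real.log_mul (pow_ne_zero 2 hQ) (pow_ne_zero 2 hT), Matrix.transpose_mul]
  simp only [Matrix.mul_assoc]
  ring

/-- The negative log-likelihood of a parameter in terms of the Gaussian loss. The sample size is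
nonzero because the inverse in `secondMoment` is junk otherwise. -/
theorem DG.IsParam.negLogLik_eq {n p : ℕ} {G : DG p} {B : Matrix (Fin p) (Fin p) ℝ}
    {σ2 : Fin p → ℝ} (h : G.IsParam B σ2) (hn : n ≠ 0) (X : Matrix (Fin n) (Fin p) ℝ) :
    negLogLik X B σ2 = n / 2 * gaussLoss (secondMoment X) (precisionFactor B σ2) := by
  have hn' : (n : ℝ) ≠ 0 := Nat.cast_ne_zero.2 hn
  have hlog : Real.log ((precisionFactor B σ2).det ^ 2) =
      2 * Real.log |(1 - B).det| - ∑ i, Real.log (σ2 i) := by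
    have hprod : ∏ i, (√(σ2 i))⁻¹ ≠ 0 :=
      Finset.prod_ne_zero_iff.2 fun i _ => inv_ne_zero (Real.sqrt_pos.2 (h.pos i)).ne'
    rw [precisionFactor, Matrix.det_mul, Matrix.det_diagonal, Real.log_pow,
      Real.log_mul h.nonsing hprod,
      Real.log_prod fun i _ => inv_ne_zero (Real.sqrt_pos.2 (h.pos i)).ne', Real.log_abs]
    simp only [Real.log_inv, Real.log_sqrt (h.pos _).le, Finset.sum_neg_distrib,
      ← Finset.sum_div]
    push_cast
    ring
  have htr : ((precisionFactor B σ2)ᵀ * secondMoment X * precisionFactor B σ2).trace =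
      (n : ℝ)⁻¹ * ∑ i, (σ2 i)⁻¹ * ∑ k, (X k i - (X * B) k i) ^ 2 := by
    have h1 : (precisionFactor B σ2)ᵀ * secondMoment X * precisionFactor B σ2 =
        (n : ℝ)⁻¹ • ((X * precisionFactor B σ2)ᵀ * (X * precisionFactor B σ2)) := by
      rw [secondMoment, Matrix.mul_smul, Matrix.smul_mul, Matrix.transpose_mul]
      simp only [Matrix.mul_assoc]
    have h2 : ∀ k i, (X * precisionFactor B σ2) k i =
        (X k i - (X * B) k i) * (√(σ2 i))⁻¹ := by
      intro k i
      rw [precisionFactor, ← Matrix.mul_assoc, Matrix.mul_diagonal, Matrix.mul_sub,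
        Matrix.mul_one, Matrix.sub_apply]
    have h3 : ∀ (A : Matrix (Fin n) (Fin p) ℝ), (Aᵀ * A).trace = ∑ i, ∑ k, A k i ^ 2 := by
      intro A
      simp only [Matrix.trace, Matrix.diag_apply, Matrix.mul_apply, Matrix.transpose_apply, sq]
    have h4 : ∀ i, (√(σ2 i))⁻¹ ^ 2 = (σ2 i)⁻¹ := fun i => by
      rw [inv_pow, Real.sq_sqrt (h.pos i).le]
    rw [h1, Matrix.trace_smul, smul_eq_mul, h3]
    simp only [h2, mul_pow, h4, mul_comm _ (σ2 _)⁻¹, ← Finset.mul_sum]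
  have h3 : ∑ i, 1 / (2 * σ2 i) * ∑ k, (X k i - (X * B) k i) ^ 2 =
      1 / 2 * ∑ i, (σ2 i)⁻¹ * ∑ k, (X k i - (X * B) k i) ^ 2 := by
    rw [Finset.mul_sum]
    refine Finset.sum_congr rfl fun i _ => ?_
    rw [one_div, mul_inv]
    ring
  rw [gaussLoss, hlog, htr, negLogLik, Finset.sum_add_distrib, ← Finset.mul_sum, h3]
  field_simp
  ring

namespace DG

variable {p : ℕ}

instance : Finite (DG p) := by
  refine Finite.of_injective (fun G : DG p => G.Adj) fun G H h => ?_
  cases G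
  cases H
  congr
  exact Digraph.ext h

/-- The graph of the weight matrix of a parameter. -/
def ofWeights (B : Matrix (Fin p) (Fin p) ℝ) (h : ∀ i, B i i = 0) : DG p where
  Adj i j := B i j ≠ 0
  loopless i hi := hi (h i)

theorem numEdges_eq_l0norm {G : DG p} {B : Matrix (Fin p) (Fin p) ℝ} (h : IsGraphOf G B) :
    G.numEdges = l0norm B := by
  rw [numEdges, l0norm, edgeSet]
  congr 1
  ext e
  exact h e.1 e.2

theorem IsParam.l0norm_le {G : DG p} {B : Matrix (Fin p) (Fin p) ℝ} {σ2 : Fin p → ℝ}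
    (h : G.IsParam B σ2) : l0norm B ≤ G.numEdges :=
  Set.ncard_le_ncard (fun e he => h.supp e.1 e.2 he) (Set.toFinite _)

theorem isClosed_setOf_mul_mem_patternSpace (G : DG p) (Q : Matrix (Fin p) (Fin p) ℝ) :
    IsClosed {T : Matrix (Fin p) (Fin p) ℝ | Q * T ∈ G.patternSpace} := by
  have hcont : Continuous fun T : Matrix (Fin p) (Fin p) ℝ =>
      (Q * T : Matrix (Fin p) (Fin p) ℝ) := by
    fun_prop
  exact (Submodule.closed_of_finiteDimensional G.patternSpace).preimage hcont

/-- An invertible matrix of the pattern space has the same Gram matrix as an invertible matrix with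
nonzero diagonal that has no more nonzero entries off the diagonal than `G` has edges: permute the
columns. -/
theorem exists_diag_ne_zero_of_mem_patternSpace {G : DG p} {Q : Matrix (Fin p) (Fin p) ℝ}
    (hQ : Q ∈ G.patternSpace) (hdet : Q.det ≠ 0) :
    ∃ R : Matrix (Fin p) (Fin p) ℝ, R * Rᵀ = Q * Qᵀ ∧ R.det ≠ 0 ∧ (∀ i, R i i ≠ 0) ∧
      {e : Fin p × Fin p | e.1 ≠ e.2 ∧ R e.1 e.2 ≠ 0}.ncard ≤ G.numEdges := by
  obtain ⟨σ, -, hσ⟩ : ∃ σ ∈ (Finset.univ : Finset (Equiv.Perm (Fin p))),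
      Equiv.Perm.sign σ • ∏ i, Q (σ i) i ≠ 0 :=
    Finset.exists_ne_zero_of_sum_ne_zero (by rwa [Matrix.det_apply] at hdet)
  have hne : ∀ i, Q (σ i) i ≠ 0 := by
    intro i h0
    refine hσ ?_
    have hz : ∏ j, Q (σ j) j = 0 := Finset.prod_eq_zero (Finset.mem_univ i) h0
    rw [hz, smul_zero]
  have hprod : Q.submatrix id σ.symm * (Q.submatrix id σ.symm)ᵀ = Q * Qᵀ := by
    ext i j
    simp only [Matrix.mul_apply, Matrix.transpose_apply, Matrix.submatrix_apply, id]
    exact Equiv.sum_comp σ.symm fun k => Q i k * Q j k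
  have hdiag : ∀ i, Q.submatrix id σ.symm i i ≠ 0 := by
    intro i
    simpa using hne (σ.symm i)
  refine ⟨Q.submatrix id σ.symm, hprod, ?_, hdiag, ?_⟩
  · intro h0
    have h1 := congrArg Matrix.det hprod
    rw [Matrix.det_mul, h0, zero_mul, Matrix.det_mul, Matrix.det_transpose] at h1
    exact hdet (mul_self_eq_zero.1 h1.symm)
  · set D : Set (Fin p × Fin p) := {e | e.1 = e.2} with hD
    have hDcard : D.ncard = p := by
      have h1 : D = (fun i => (i, i)) '' (Set.univ : Set (Fin p)) := by
        ext ⟨i, j⟩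
        simp [hD, eq_comm]
      rw [h1, Set.ncard_image_of_injective _ fun i j h => (Prod.mk.inj h).1, Set.ncard_univ,
        Nat.card_fin]
    have h1 : ({e : Fin p × Fin p | e.1 ≠ e.2 ∧ Q.submatrix id σ.symm e.1 e.2 ≠ 0} ∪ D) =
        (fun e : Fin p × Fin p => (e.1, σ e.2)) '' {e | Q e.1 e.2 ≠ 0} := by
      ext ⟨i, j⟩
      simp only [Set.mem_union, Set.mem_ofPred_eq, hD, Set.mem_image, Prod.exists, Prod.mk.injEq]
      constructor
      · intro h
        refine ⟨i, σ.symm j, ?_, rfl, by simp⟩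
        rcases h with h | h
        · exact h.2
        · subst h
          exact hdiag i
      · rintro ⟨a, b, hab, rfl, rfl⟩
        by_cases h : a = σ b
        · exact Or.inr h
        · exact Or.inl ⟨h, by simpa using hab⟩
    have h2 : Disjoint {e : Fin p × Fin p | e.1 ≠ e.2 ∧ Q.submatrix id σ.symm e.1 e.2 ≠ 0} D :=
      Set.disjoint_left.2 fun e he he' => he.1 he'
    have h3 := Set.ncard_union_eq h2 (Set.toFinite _) (Set.toFinite _)
    have hinj : Function.Injective fun e : Fin p × Fin p => (e.1, σ e.2) := by
      rintro ⟨a, b⟩ ⟨c, d⟩ h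
      simpa using h
    rw [h1, Set.ncard_image_of_injective _ hinj, hDcard] at h3
    have h4 : {e : Fin p × Fin p | Q e.1 e.2 ≠ 0} ⊆ G.edgeSet ∪ D := by
      rintro ⟨i, j⟩ h
      by_cases hij : i = j
      · exact Or.inr hij
      · refine Or.inl ?_
        by_contra hadj
        exact h (hQ i j hij hadj)
    have h5 := (Set.ncard_le_ncard h4 (Set.toFinite _)).trans (Set.ncard_union_le _ _)
    rw [hDcard] at h5
    rw [numEdges]
    omega

/-- If the second moment matrix is close to the one of the model, the penalized score has a global
minimizer. -/
theorem exists_isGlobalMinimizer {n : ℕ} (hn : n ≠ 0) (X : Matrix (Fin n) (Fin p) ℝ) {lam : ℝ}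
    (hlam : 0 ≤ lam) {Q : Matrix (Fin p) (Fin p) ℝ} (hQ : Q.det ≠ 0)
    (hM : sqDistOne (Qᵀ * secondMoment X * Q) ≤ 1 / 4) :
    ∃ (G : DG p) (B : Matrix (Fin p) (Fin p) ℝ) (σ2 : Fin p → ℝ),
      IsGlobalMinimizer X lam G B σ2 := by
  have hQu : IsUnit Q.det := isUnit_iff_ne_zero.2 hQ
  have key : ∀ G : DG p, ∃ R : Matrix (Fin p) (Fin p) ℝ, R ∈ G.patternSpace ∧ R.det ≠ 0 ∧
      ∀ R' : Matrix (Fin p) (Fin p) ℝ, R' ∈ G.patternSpace → R'.det ≠ 0 →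
        gaussLoss (secondMoment X) R ≤ gaussLoss (secondMoment X) R' := by
    intro G
    -- `Q * Q⁻¹ = 1` lies in every pattern space.
    obtain ⟨T, hTW, hT, hmin⟩ := exists_minimizer_gaussLoss hM
      (G.isClosed_setOf_mul_mem_patternSpace Q) (T₀ := Q⁻¹)
      (by
        rw [Set.mem_ofPred_eq, Matrix.mul_nonsing_inv _ hQu]
        exact fun i j hij _ => Matrix.one_apply_ne hij)
      (by simpa [Matrix.det_nonsing_inv] using hQ)
    refine ⟨Q * T, hTW, by rw [Matrix.det_mul]; exact mul_ne_zero hQ hT, fun R' hR' hdet' => ?_⟩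
    have hR'eq : Q * (Q⁻¹ * R') = R' := by
      rw [← Matrix.mul_assoc, Matrix.mul_nonsing_inv _ hQu, Matrix.one_mul]
    have hdetT' : (Q⁻¹ * R').det ≠ 0 := by
      intro h0
      rw [← hR'eq, Matrix.det_mul, h0, mul_zero] at hdet'
      exact hdet' rfl
    have h1 := hmin (Q⁻¹ * R') (by rwa [Set.mem_ofPred_eq, hR'eq]) hdetT'
    rw [← hR'eq, gaussLoss_mul hQ hT, gaussLoss_mul hQ hdetT']
    linarith
  choose R hRW hRdet hRmin using key
  -- The minimizer for the best graph need not come from a parameter, as its diagonal may have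
  -- zeros; a permutation of the columns repairs this without raising the number of edges.
  have : Nonempty (DG p) := ⟨edgeless p⟩
  obtain ⟨G, hG⟩ := Finite.exists_min fun G : DG p =>
    (n : ℝ) / 2 * gaussLoss (secondMoment X) (R G) + lam * G.numEdges
  obtain ⟨R', hR'R, hR'det, hR'diag, hR'card⟩ :=
    exists_diag_ne_zero_of_mem_patternSpace (hRW G) (hRdet G)
  have hB : ∀ i, weightsOfFactor R' i i = 0 := fun i => by
    by_contra hne
    exact ((weightsOfFactor_ne_zero_iff hR'diag i i).1 hne).1 rfl
  have hparam : (ofWeights (weightsOfFactor R') hB).IsParam (weightsOfFactor R')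
      (fun i => (R' i i ^ 2)⁻¹) :=
    isParam_weightsOfFactor
      (fun i j hij hne => (weightsOfFactor_ne_zero_iff hR'diag i j).2 ⟨hij, hne⟩) hR'diag hR'det
  refine ⟨_, _, _, hparam, fun G' B' σ2' h' => ?_⟩
  have hcard : l0norm (weightsOfFactor R') ≤ G.numEdges := by
    refine le_trans (le_of_eq ?_) hR'card
    rw [l0norm]
    congr 1
    ext e
    exact weightsOfFactor_ne_zero_iff hR'diag e.1 e.2
  have hloss : gaussLoss (secondMoment X) (precisionFactor (weightsOfFactor R')
      (fun i => (R' i i ^ 2)⁻¹)) = gaussLoss (secondMoment X) (R G) := by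
    refine gaussLoss_congr ?_
    rw [hparam.precisionFactor_mul_transpose, precisionMatrix_weightsOfFactor hR'diag, hR'R]
  have hleft : l0Score X lam (weightsOfFactor R') (fun i => (R' i i ^ 2)⁻¹) ≤
      (n : ℝ) / 2 * gaussLoss (secondMoment X) (R G) + lam * G.numEdges := by
    rw [l0Score, hparam.negLogLik_eq hn, hloss]
    have : (l0norm (weightsOfFactor R') : ℝ) ≤ G.numEdges := by exact_mod_cast hcard
    gcongr
  refine hleft.trans ((hG (ofWeights B' h'.diag_eq_zero)).trans ?_)
  rw [l0Score, h'.negLogLik_eq hn, numEdges_eq_l0norm (B := B') fun i j => Iff.rfl]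
  have := hRmin (ofWeights B' h'.diag_eq_zero) (precisionFactor B' σ2')
    (precisionFactor_mem_patternSpace (fun i j h => h) σ2') h'.precisionFactor_det_ne_zero
  gcongr

end DG

/-! ### Outputs for well-behaved samples -/

theorem trace_le_add_sqrt_sqDistOne {p : ℕ} (M : Matrix (Fin p) (Fin p) ℝ) :
    M.trace ≤ p + p * √(sqDistOne M) := by
  have h : ∀ i, M i i ≤ 1 + √(sqDistOne M) := by
    intro i
    have h1 : (M i i - (1 : Matrix (Fin p) (Fin p) ℝ) i i) ^ 2 ≤ sqDistOne M :=
      (Finset.single_le_sum (f := fun j => (M i j - (1 : Matrix (Fin p) (Fin p) ℝ) i j) ^ 2)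
        (fun _ _ => sq_nonneg _) (Finset.mem_univ i)).trans
        (Finset.single_le_sum
          (f := fun i => ∑ j, (M i j - (1 : Matrix (Fin p) (Fin p) ℝ) i j) ^ 2)
          (fun _ _ => Finset.sum_nonneg fun _ _ => sq_nonneg _) (Finset.mem_univ i))
    rw [Matrix.one_apply_eq] at h1
    linarith [(abs_le.1 (Real.abs_le_sqrt h1)).2]
  calc M.trace = ∑ i, M i i := rfl
    _ ≤ ∑ _i : Fin p, (1 + √(sqDistOne M)) := Finset.sum_le_sum fun i _ => h i
    _ = p + p * √(sqDistOne M) := by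
      rw [Finset.sum_const, Finset.card_univ, Fintype.card_fin, nsmul_eq_mul]
      ring

theorem gaussLoss_one {p : ℕ} (M : Matrix (Fin p) (Fin p) ℝ) : gaussLoss M 1 = M.trace := by
  simp [gaussLoss]

theorem isHermitian_conj_secondMoment {n p : ℕ} (X : Matrix (Fin n) (Fin p) ℝ)
    (Q : Matrix (Fin p) (Fin p) ℝ) : (Qᵀ * secondMoment X * Q).IsHermitian := by
  rw [Matrix.IsHermitian, Matrix.conjTranspose_eq_transpose_of_trivial, secondMoment]
  simp only [Matrix.transpose_mul, Matrix.transpose_smul, Matrix.transpose_transpose,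
    Matrix.mul_assoc]

namespace DG

variable {p : ℕ}

/-- The comparison of an output of the penalized estimator with a parameter that generates the
precision matrix `Q * Qᵀ`, in the coordinates in which `Q` is the identity. -/
theorem exists_gaussLoss_le_of_isL0Output {n : ℕ} (hn : n ≠ 0) {X : Matrix (Fin n) (Fin p) ℝ}
    {lam : ℝ} (hlam : 0 ≤ lam) {Ghat G : DG p} (hout : IsL0Output X lam Ghat)
    {Q : Matrix (Fin p) (Fin p) ℝ} (hQ : Q.det ≠ 0) (hG : Q * Qᵀ ∈ G.distSet) :
    ∃ T : Matrix (Fin p) (Fin p) ℝ, Q * T ∈ Ghat.patternSpace ∧ T.det ≠ 0 ∧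
      n / 2 * gaussLoss (Qᵀ * secondMoment X * Q) T + lam * Ghat.numEdges ≤
        n / 2 * (Qᵀ * secondMoment X * Q).trace + lam * G.numEdges := by
  obtain ⟨G₀, B₀, τ, hmin, hgraph⟩ := hout
  obtain ⟨B, σ2, hparam, hQQ⟩ := hG
  have hQu : IsUnit Q.det := isUnit_iff_ne_zero.2 hQ
  have hQT : Q * (Q⁻¹ * precisionFactor B₀ τ) = precisionFactor B₀ τ := by
    rw [← Matrix.mul_assoc, Matrix.mul_nonsing_inv _ hQu, Matrix.one_mul]
  have hdet : (Q⁻¹ * precisionFactor B₀ τ).det ≠ 0 := by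
    intro h0
    have h1 := congrArg Matrix.det hQT
    rw [Matrix.det_mul, h0, mul_zero] at h1
    exact hmin.feasible.precisionFactor_det_ne_zero h1.symm
  refine ⟨Q⁻¹ * precisionFactor B₀ τ, ?_, hdet, ?_⟩
  · rw [hQT]
    exact precisionFactor_mem_patternSpace (fun i j h => (hgraph i j).2 h) τ
  · have h1 := hmin.minimal G B σ2 hparam
    have h2 : gaussLoss (secondMoment X) (precisionFactor B σ2) =
        gaussLoss (secondMoment X) Q :=
      gaussLoss_congr (by rw [hparam.precisionFactor_mul_transpose, hQQ])
    have h3 := gaussLoss_mul (S := secondMoment X) hQ hdet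
    have h4 := gaussLoss_mul (S := secondMoment X) (T := 1) hQ (by simp)
    rw [hQT] at h3
    rw [Matrix.mul_one, gaussLoss_one] at h4
    rw [l0Score, l0Score, hmin.feasible.negLogLik_eq hn, hparam.negLogLik_eq hn, h2, h3, h4,
      ← numEdges_eq_l0norm hgraph] at h1
    have h5 : lam * (l0norm B : ℝ) ≤ lam * G.numEdges := by
      have : (l0norm B : ℝ) ≤ G.numEdges := by exact_mod_cast hparam.l0norm_le
      gcongr
    linarith

/-- If the empirical second moments are close to those of the model, at the scale `log n / n`, then
an output of the penalized estimator has no more edges than a graph that generates the precision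
matrix: the gain in likelihood is less than the penalty of one edge. -/
theorem numEdges_le_of_isL0Output {n : ℕ} (hn : 2 ≤ n) {X : Matrix (Fin n) (Fin p) ℝ}
    {Ghat G : DG p} (hout : IsL0Output X (0.5 * Real.log n) Ghat)
    {Q : Matrix (Fin p) (Fin p) ℝ} (hQ : Q.det ≠ 0) (hG : Q * Qᵀ ∈ G.distSet)
    (hM : sqDistOne (Qᵀ * secondMoment X * Q) ≤ 1 / 4)
    (hMn : sqDistOne (Qᵀ * secondMoment X * Q) ≤ Real.log n / (4 * n)) :
    Ghat.numEdges ≤ G.numEdges := by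
  have hn0 : (0 : ℝ) < n := by exact_mod_cast (by omega : 0 < n)
  have hlog : 0 < Real.log n := Real.log_pos (by exact_mod_cast (by omega : 1 < n))
  obtain ⟨T, -, hT, hle⟩ := exists_gaussLoss_le_of_isL0Output (by omega) (by positivity) hout hQ hG
  have hpos : (Qᵀ * secondMoment X * Q).PosDef :=
    posDef_of_sqDistOne_le (isHermitian_conj_secondMoment X Q) hM
  have h1 := le_gaussLoss hpos hT
  have h2 := Matrix.PosDef.trace_sub_log_det_le hpos hM
  have h3 : (n : ℝ) / 2 * (Qᵀ * secondMoment X * Q).trace ≤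
      n / 2 * (gaussLoss (Qᵀ * secondMoment X * Q) T + 2 * (Real.log n / (4 * n))) := by
    have : (Qᵀ * secondMoment X * Q).trace ≤
        gaussLoss (Qᵀ * secondMoment X * Q) T + 2 * (Real.log n / (4 * n)) := by linarith
    gcongr
  have h4 : (n : ℝ) / 2 * (2 * (Real.log n / (4 * n))) = Real.log n / 4 := by
    field_simp
  rw [mul_add, h4] at h3
  have h5 : Real.log n * ((Ghat.numEdges : ℝ) - G.numEdges - 1 / 2) ≤ 0 := by linarith
  have h6 : (Ghat.numEdges : ℝ) - G.numEdges - 1 / 2 ≤ 0 := by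
    by_contra h
    exact absurd h5 (not_le.2 (mul_pos hlog (not_le.1 h)))
  have h7 : (Ghat.numEdges : ℝ) < G.numEdges + 1 := by linarith
  have h8 : Ghat.numEdges < G.numEdges + 1 := by exact_mod_cast h7
  omega

theorem tendsto_log_div_four_mul :
    Tendsto (fun n : ℕ => Real.log n / (4 * n)) atTop (𝓝 0) := by
  have h := (Real.isLittleO_log_id_atTop.tendsto_div_nhds_zero.comp
    tendsto_natCast_atTop_atTop).div_const 4
  rw [zero_div] at h
  refine h.congr fun n => ?_
  simp only [Function.comp, id]
  rw [div_div, mul_comm]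

/-- For large samples whose second moments are close to those of the model, a graph that cannot
generate the precision matrix, even in the closure of its parameters, is not an output. -/
theorem eventually_not_isL0Output {Ghat G : DG p} {Q : Matrix (Fin p) (Fin p) ℝ} (hQ : Q.det ≠ 0)
    (hG : Q * Qᵀ ∈ G.distSet)
    (hno : ∀ R : Matrix (Fin p) (Fin p) ℝ, R ∈ Ghat.patternSpace → Q * Qᵀ ≠ R * Rᵀ) :
    ∀ᶠ n : ℕ in atTop, ∀ X : Matrix (Fin n) (Fin p) ℝ,
      sqDistOne (Qᵀ * secondMoment X * Q) ≤ Real.log n / (4 * n) →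
        ¬ IsL0Output X (0.5 * Real.log n) Ghat := by
  obtain ⟨ε, hε, hgap⟩ := exists_gap_gaussLoss (Ghat.isClosed_setOf_mul_mem_patternSpace Q)
    (fun T hT hTT => hno (Q * T) hT (by
      rw [Matrix.transpose_mul, Matrix.mul_assoc, ← Matrix.mul_assoc T, hTT, Matrix.one_mul]))
  have hlim : Tendsto (fun n : ℕ => (p : ℝ) * √(Real.log n / (4 * n)) +
      4 * (Real.log n / (4 * n)) * G.numEdges) atTop (𝓝 0) := by
    have h1 := (Real.continuous_sqrt.tendsto 0).comp tendsto_log_div_four_mul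
    rw [Real.sqrt_zero] at h1
    simpa using (h1.const_mul (p : ℝ)).add
      ((tendsto_log_div_four_mul.const_mul 4).mul_const (G.numEdges : ℝ))
  filter_upwards [hlim.eventually_lt_const hε, tendsto_log_div_four_mul.eventually_lt_const hε,
    eventually_ge_atTop 2] with n hn1 hn2 hn X hX hout
  have hn0 : (0 : ℝ) < n := by exact_mod_cast (by omega : 0 < n)
  have hlog : 0 < Real.log n := Real.log_pos (by exact_mod_cast (by omega : 1 < n))
  obtain ⟨T, hTW, hT, hle⟩ :=
    exists_gaussLoss_le_of_isL0Output (by omega) (by positivity) hout hQ hG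
  have h1 := hgap _ (hX.trans hn2.le) T hTW hT
  have h2 := trace_le_add_sqrt_sqDistOne (Qᵀ * secondMoment X * Q)
  have h3 : (p : ℝ) * √(sqDistOne (Qᵀ * secondMoment X * Q)) ≤
      p * √(Real.log n / (4 * n)) := by gcongr
  have h4 : (0.5 * Real.log n) * (G.numEdges : ℝ) =
      n / 2 * (4 * (Real.log n / (4 * n)) * G.numEdges) := by
    field_simp
    ring
  have h5 : 0 ≤ (0.5 * Real.log n) * (Ghat.numEdges : ℝ) := by positivity
  rw [h4] at hle
  have h6 : (n : ℝ) / 2 * gaussLoss (Qᵀ * secondMoment X * Q) T ≤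
      n / 2 * ((Qᵀ * secondMoment X * Q).trace + 4 * (Real.log n / (4 * n)) * G.numEdges) := by
    linarith
  have h7 := le_of_mul_le_mul_left h6 (by positivity)
  linarith

/-- The deterministic part of the consistency of the penalized estimator: for large samples whose
second moments are close to those of the model, the score has a minimizer and every output is quasi
equivalent to the graph of the model. -/
theorem eventually_quasiEquiv_of_isL0Output {Gstar Gdag : DG p} {Q : Matrix (Fin p) (Fin p) ℝ}
    (hQ : Q.det ≠ 0) (hmem : Q * Qᵀ ∈ Gstar.distSet) (hfaith : GFaithful (Q * Qᵀ) Gstar)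
    (hequiv : Gdag.DistEquiv Gstar) (hmin : Gdag.MinimalEdges) :
    ∀ᶠ n : ℕ in atTop, ∀ X : Matrix (Fin n) (Fin p) ℝ,
      sqDistOne (Qᵀ * secondMoment X * Q) ≤ Real.log n / (4 * n) →
        (∃ Ghat : DG p, IsL0Output X (0.5 * Real.log n) Ghat) ∧
          ∀ Ghat : DG p, IsL0Output X (0.5 * Real.log n) Ghat → Ghat.QuasiEquiv Gstar := by
  have hdag : Q * Qᵀ ∈ Gdag.distSet := by
    rw [DistEquiv] at hequiv
    rwa [hequiv]
  have hall : ∀ᶠ n : ℕ in atTop, ∀ Ghat : DG p,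
      (∀ R : Matrix (Fin p) (Fin p) ℝ, R ∈ Ghat.patternSpace → Q * Qᵀ ≠ R * Rᵀ) →
      ∀ X : Matrix (Fin n) (Fin p) ℝ,
      sqDistOne (Qᵀ * secondMoment X * Q) ≤ Real.log n / (4 * n) →
        ¬ IsL0Output X (0.5 * Real.log n) Ghat := by
    rw [eventually_all]
    intro Ghat
    by_cases hno : ∀ R : Matrix (Fin p) (Fin p) ℝ, R ∈ Ghat.patternSpace → Q * Qᵀ ≠ R * Rᵀ
    · exact (eventually_not_isL0Output hQ hdag hno).mono fun n hn _ => hn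
    · exact Eventually.of_forall fun n h => absurd h hno
  filter_upwards [hall, eventually_ge_atTop 2,
    tendsto_log_div_four_mul.eventually_lt_const (by norm_num : (0 : ℝ) < 1 / 4)]
    with n hn hn2 hn4 X hX
  have hlog : 0 ≤ 0.5 * Real.log n :=
    mul_nonneg (by norm_num) (Real.log_natCast_nonneg n)
  have hX4 := hX.trans hn4.le
  constructor
  · obtain ⟨G, B, σ2, h⟩ := exists_isGlobalMinimizer (by omega) X hlog hQ hX4
    exact ⟨ofWeights B h.feasible.diag_eq_zero, G, B, σ2, h, fun i j => Iff.rfl⟩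
  · intro Ghat hout
    have hcard := numEdges_le_of_isL0Output hn2 hout hQ hdag hX4 hX
    by_contra hne
    refine hn Ghat (fun R hR hQR => hne ?_) X hX hout
    exact quasiEquiv_of_gFaithful hmem hfaith hequiv hmin hR hQR hcard

end DG

/-! ### Second moments of the noise and consistency -/

/-- Chebyshev's inequality at the scale `√(log n / n)`: the empirical mean of pairwise independent
variables with the same mean and bounded variances stays within this distance of the mean, with
probability tending to one. -/
theorem tendsto_measure_le_abs_mean_sub {S : Type*} [MeasurableSpace S] {P : Measure S}
    [IsProbabilityMeasure P] {Y : ℕ → S → ℝ} {m C a : ℝ} (ha : 0 < a)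
    (hY : ∀ k, MemLp (Y k) 2 P) (hmean : ∀ k, ∫ s, Y k s ∂P = m)
    (hvar : ∀ k, variance (Y k) P ≤ C)
    (hindep : Pairwise fun k l => IndepFun (Y k) (Y l) P) :
    Tendsto (fun n : ℕ => P {s | a * √(Real.log n / n) ≤
      |(n : ℝ)⁻¹ * ∑ k ∈ Finset.range n, Y k s - m|}) atTop (𝓝 0) := by
  have hlim : Tendsto (fun n : ℕ => ENNReal.ofReal (C / a ^ 2 * (Real.log n)⁻¹)) atTop (𝓝 0) := by
    have h1 := (Real.tendsto_log_atTop.comp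
      tendsto_natCast_atTop_atTop).inv_tendsto_atTop.const_mul (C / a ^ 2)
    rw [mul_zero] at h1
    simpa using ENNReal.tendsto_ofReal h1
  refine tendsto_of_tendsto_of_tendsto_of_le_of_le' tendsto_const_nhds hlim
    (Eventually.of_forall fun _ => zero_le) ?_
  filter_upwards [eventually_ge_atTop 2] with n hn
  have hn0 : (0 : ℝ) < n := by exact_mod_cast (by omega : 0 < n)
  have hlog : 0 < Real.log n := Real.log_pos (by exact_mod_cast (by omega : 1 < n))
  have hsum : MemLp (fun s => ∑ k ∈ Finset.range n, Y k s) 2 P :=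
    memLp_finsetSum _ fun k _ => hY k
  have hmeanA : ∫ s, (n : ℝ)⁻¹ * ∑ k ∈ Finset.range n, Y k s ∂P = m := by
    rw [integral_const_mul, integral_finsetSum _ fun k _ => (hY k).integrable one_le_two]
    simp only [hmean, Finset.sum_const, Finset.card_range, nsmul_eq_mul]
    field_simp
  have hvarA : variance (fun s => (n : ℝ)⁻¹ * ∑ k ∈ Finset.range n, Y k s) P ≤ C / n := by
    have h1 : (fun s => ∑ k ∈ Finset.range n, Y k s) = ∑ k ∈ Finset.range n, Y k := by
      ext s
      rw [Finset.sum_apply]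
    rw [variance_const_mul, h1, IndepFun.variance_sum (fun k _ => hY k)
      fun k _ l _ hkl => hindep hkl]
    calc (n : ℝ)⁻¹ ^ 2 * ∑ k ∈ Finset.range n, variance (Y k) P
        ≤ (n : ℝ)⁻¹ ^ 2 * ∑ _k ∈ Finset.range n, C := by
          gcongr with k
          exact hvar k
      _ = C / n := by
          rw [Finset.sum_const, Finset.card_range, nsmul_eq_mul]
          field_simp
  have h2 := meas_ge_le_variance_div_sq (hsum.const_mul (n : ℝ)⁻¹)
    (c := a * √(Real.log n / n)) (by positivity)
  rw [hmeanA] at h2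
  refine h2.trans (ENNReal.ofReal_le_ofReal ?_)
  rw [mul_pow, Real.sq_sqrt (by positivity)]
  calc variance (fun s => (n : ℝ)⁻¹ * ∑ k ∈ Finset.range n, Y k s) P / (a ^ 2 * (Real.log n / n))
      ≤ C / n / (a ^ 2 * (Real.log n / n)) := by gcongr
    _ = C / a ^ 2 * (Real.log n)⁻¹ := by field_simp

section StandardGaussian

variable {S : Type*} [MeasurableSpace S] {P : Measure S}

theorem integrable_pow_four_of_hasLaw {Z : S → ℝ} (h : HasLaw Z (gaussianReal 0 1) P) :
    Integrable (fun s => Z s ^ 4) P := by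
  have h1 : MemLp Z 4 P := by
    have h2 := memLp_id_gaussianReal' (μ := 0) (v := 1) 4 (by norm_num)
    rw [← h.map_eq] at h2
    exact (memLp_map_measure_iff h2.1 h.aemeasurable).1 h2
  have h3 := MemLp.integrable_norm_pow (p := 4) h1 (by norm_num)
  refine h3.congr (Eventually.of_forall fun s => ?_)
  simp only [Real.norm_eq_abs]
  exact Even.pow_abs (by decide) _

theorem integral_pow_four_of_hasLaw {Z : S → ℝ} (h : HasLaw Z (gaussianReal 0 1) P) :
    ∫ s, Z s ^ 4 ∂P = ∫ x, x ^ 4 ∂(gaussianReal 0 1) :=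
  h.integral_comp (f := fun x => x ^ 4) (by fun_prop)

theorem sq_mul_le_half_add (a b : ℝ) : (a * b) ^ 2 ≤ 1 / 2 * (a ^ 4 + b ^ 4) := by
  nlinarith [sq_nonneg (a ^ 2 - b ^ 2)]

theorem memLp_mul_of_hasLaw {Z W : S → ℝ} (hZ : HasLaw Z (gaussianReal 0 1) P)
    (hW : HasLaw W (gaussianReal 0 1) P) : MemLp (fun s => Z s * W s) 2 P := by
  have hm : AEStronglyMeasurable (fun s => Z s * W s) P :=
    (hZ.aemeasurable.mul hW.aemeasurable).aestronglyMeasurable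
  refine (memLp_two_iff_integrable_sq hm).2 (Integrable.mono'
    (((integrable_pow_four_of_hasLaw hZ).add (integrable_pow_four_of_hasLaw hW)).const_mul (1 / 2))
    (hm.pow 2) (Eventually.of_forall fun s => ?_))
  rw [Real.norm_eq_abs, abs_of_nonneg (sq_nonneg _)]
  exact sq_mul_le_half_add _ _

theorem variance_mul_le_of_hasLaw [IsProbabilityMeasure P] {Z W : S → ℝ}
    (hZ : HasLaw Z (gaussianReal 0 1) P)
    (hW : HasLaw W (gaussianReal 0 1) P) :
    variance (fun s => Z s * W s) P ≤ ∫ x, x ^ 4 ∂(gaussianReal 0 1) := by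
  have hmem := memLp_mul_of_hasLaw hZ hW
  refine (variance_le_expectation_sq hmem.1).trans ?_
  have h4 := (integrable_pow_four_of_hasLaw hZ).add (integrable_pow_four_of_hasLaw hW)
  have h1 : ∫ s, ((fun s => Z s * W s) ^ 2) s ∂P ≤ ∫ s, 1 / 2 * (Z s ^ 4 + W s ^ 4) ∂P :=
    integral_mono hmem.integrable_sq (h4.const_mul (1 / 2)) fun s => sq_mul_le_half_add _ _
  rw [integral_const_mul, integral_add (integrable_pow_four_of_hasLaw hZ)
    (integrable_pow_four_of_hasLaw hW), integral_pow_four_of_hasLaw hZ,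
    integral_pow_four_of_hasLaw hW] at h1
  linarith

theorem integral_of_hasLaw_gaussianReal {Z : S → ℝ} (h : HasLaw Z (gaussianReal 0 1) P) :
    ∫ s, Z s ∂P = 0 := by
  rw [h.integral_eq, integral_id_gaussianReal]

theorem integral_mul_self_of_hasLaw {Z : S → ℝ} (h : HasLaw Z (gaussianReal 0 1) P) :
    ∫ s, Z s * Z s ∂P = 1 := by
  have h1 : variance Z P = 1 := by
    rw [h.variance_eq, variance_id_gaussianReal]
    rfl
  rw [variance_of_integral_eq_zero h.aemeasurable (integral_of_hasLaw_gaussianReal h)] at h1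
  simpa only [sq] using h1

/-- The empirical second moments of standard Gaussian vectors with independent coordinates are close
to the identity, at the scale `log n / n` for the squared distance, with probability tending to
one. -/
theorem tendsto_measure_lt_sqDistOne [IsProbabilityMeasure P] {p : ℕ} {Z : ℕ → Fin p → S → ℝ}
    (hlaw : ∀ k i, HasLaw (Z k i) (gaussianReal 0 1) P)
    (hindep : iIndepFun (fun ki : ℕ × Fin p => Z ki.1 ki.2) P) :
    Tendsto (fun n : ℕ => P {s | Real.log n / (4 * n) < sqDistOne (Matrix.of fun i j : Fin p =>
      (n : ℝ)⁻¹ * ∑ k ∈ Finset.range n, Z k i s * Z k j s)}) atTop (𝓝 0) := by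
  -- If all `p ^ 2` entries deviate by less than `a √(log n / n)`, then the squared distance is at
  -- most `(p a) ^ 2 log n / n`, and `p a ≤ 1 / 2`.
  set a : ℝ := (2 * (p + 1))⁻¹ with ha
  have ha0 : 0 < a := by positivity
  set bad : Fin p → Fin p → ℕ → Set S := fun i j n => {s | a * √(Real.log n / n) ≤
    |(n : ℝ)⁻¹ * ∑ k ∈ Finset.range n, Z k i s * Z k j s -
      (1 : Matrix (Fin p) (Fin p) ℝ) i j|} with hbad
  have hentry : ∀ i j, Tendsto (fun n => P (bad i j n)) atTop (𝓝 0) := by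
    intro i j
    refine tendsto_measure_le_abs_mean_sub (Y := fun k s => Z k i s * Z k j s) ha0
      (fun k => memLp_mul_of_hasLaw (hlaw k i) (hlaw k j)) (fun k => ?_)
      (fun k => variance_mul_le_of_hasLaw (hlaw k i) (hlaw k j)) fun k l hkl => ?_
    · by_cases hij : i = j
      · subst hij
        rw [Matrix.one_apply_eq]
        exact integral_mul_self_of_hasLaw (hlaw k i)
      · rw [Matrix.one_apply_ne hij]
        have hne : ((k, i) : ℕ × Fin p) ≠ (k, j) := fun h => hij (Prod.mk.inj h).2
        rw [(hindep.indepFun hne).integral_fun_mul_eq_mul_integral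
          (hlaw k i).aemeasurable.aestronglyMeasurable (hlaw k j).aemeasurable.aestronglyMeasurable]
        simp only [integral_of_hasLaw_gaussianReal (hlaw k i), zero_mul]
    · have hne : ∀ i j : Fin p, ((k, i) : ℕ × Fin p) ≠ (l, j) := fun i j h =>
        hkl (Prod.mk.inj h).1
      exact (hindep.indepFun_prodMk_prodMk₀ (fun ki => (hlaw ki.1 ki.2).aemeasurable)
        (k, i) (k, j) (l, i) (l, j) (hne _ _) (hne _ _) (hne _ _) (hne _ _)).comp
        (φ := fun x : ℝ × ℝ => x.1 * x.2) (ψ := fun x : ℝ × ℝ => x.1 * x.2)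
        (by fun_prop) (by fun_prop)
  have hsum : Tendsto (fun n => ∑ i, ∑ j, P (bad i j n)) atTop (𝓝 0) := by
    simpa using tendsto_finsetSum Finset.univ fun i _ =>
      tendsto_finsetSum Finset.univ fun j _ => hentry i j
  refine tendsto_of_tendsto_of_tendsto_of_le_of_le tendsto_const_nhds hsum
    (fun _ => zero_le) fun n => ?_
  refine (measure_mono ?_).trans ((measure_iUnion_fintype_le P fun i => ⋃ j, bad i j n).trans
    (Finset.sum_le_sum fun i _ => measure_iUnion_fintype_le P fun j => bad i j n))
  intro s hs
  by_contra hcon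
  simp only [Set.mem_iUnion, not_exists, hbad, Set.mem_ofPred_eq, not_le] at hcon
  refine absurd (show Real.log n / (4 * n) < _ from hs) (not_lt.2 ?_)
  have hlog : 0 ≤ Real.log n / n := div_nonneg (Real.log_natCast_nonneg n) (Nat.cast_nonneg n)
  have hterm : ∀ i j, ((Matrix.of fun i j : Fin p => (n : ℝ)⁻¹ * ∑ k ∈ Finset.range n,
      Z k i s * Z k j s) i j - (1 : Matrix (Fin p) (Fin p) ℝ) i j) ^ 2 ≤
        a ^ 2 * (Real.log n / n) := by
    intro i j
    rw [← sq_abs, ← Real.sq_sqrt hlog, ← mul_pow]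
    exact pow_le_pow_left₀ (abs_nonneg _) (hcon i j).le 2
  have hpa : (p : ℝ) * a ≤ 1 / 2 := by
    rw [ha, ← div_eq_mul_inv, div_le_div_iff₀ (by positivity) (by norm_num)]
    linarith
  calc sqDistOne (Matrix.of fun i j : Fin p => (n : ℝ)⁻¹ * ∑ k ∈ Finset.range n, Z k i s * Z k j s)
      ≤ ∑ _i : Fin p, ∑ _j : Fin p, a ^ 2 * (Real.log n / n) :=
        Finset.sum_le_sum fun i _ => Finset.sum_le_sum fun j _ => hterm i j
    _ = (p * a) ^ 2 * (Real.log n / n) := by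
        simp only [Finset.sum_const, Finset.card_univ, Fintype.card_fin, nsmul_eq_mul]
        ring
    _ ≤ (1 / 2) ^ 2 * (Real.log n / n) := by gcongr
    _ = Real.log n / (4 * n) := by ring

end StandardGaussian

/-- In the coordinates in which the precision matrix of the model is the identity, the second
moments of the data are those of the normalized noise. -/
theorem conj_secondMoment_eq {n p : ℕ} {B : Matrix (Fin p) (Fin p) ℝ} {σ2 : Fin p → ℝ}
    {X N : Matrix (Fin n) (Fin p) ℝ} (hX : X = X * B + N) (i j : Fin p) :
    ((precisionFactor B σ2)ᵀ * secondMoment X * precisionFactor B σ2) i j =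
      (n : ℝ)⁻¹ * ∑ k, N k i * (√(σ2 i))⁻¹ * (N k j * (√(σ2 j))⁻¹) := by
  have hN : X * precisionFactor B σ2 = N * Matrix.diagonal fun i => (√(σ2 i))⁻¹ := by
    have h1 : X * (1 - B) = N := by
      rw [Matrix.mul_sub, Matrix.mul_one, sub_eq_iff_eq_add']
      exact hX
    rw [precisionFactor, ← Matrix.mul_assoc, h1]
  have h2 : (precisionFactor B σ2)ᵀ * secondMoment X * precisionFactor B σ2 =
      (n : ℝ)⁻¹ • ((X * precisionFactor B σ2)ᵀ * (X * precisionFactor B σ2)) := by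
    rw [secondMoment, Matrix.mul_smul, Matrix.smul_mul, Matrix.transpose_mul]
    simp only [Matrix.mul_assoc]
  rw [h2, hN, Matrix.smul_apply, smul_eq_mul, Matrix.mul_apply]
  simp only [Matrix.transpose_apply, Matrix.mul_diagonal]

theorem hasLaw_gaussianReal_div_sqrt {S : Type*} [MeasurableSpace S] {P : Measure S} {N : S → ℝ}
    {v : ℝ} (hv : 0 < v) (h : HasLaw N (gaussianReal 0 v.toNNReal) P) :
    HasLaw (fun s => N s * (√v)⁻¹) (gaussianReal 0 1) P := by
  have h1 := gaussianReal_mul_const h (√v)⁻¹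
  rw [mul_zero] at h1
  convert h1
  ext
  simp [hv.le, Real.sq_sqrt, hv.ne']

theorem mainTheorem5 {p : ℕ} (Gstar : DG p)
    (B : Matrix (Fin p) (Fin p) ℝ) (σ2 : Fin p → ℝ) (hparam : Gstar.IsParam B σ2)
    (hfaithful : GFaithful (precisionMatrix B σ2) Gstar)
    (hmin : ∃ Gdag : DG p, Gdag.DistEquiv Gstar ∧ ¬ Gdag.Reducible ∧ Gdag.MinimalEdges)
    {S : Type*} [MeasurableSpace S] (P : Measure S) [IsProbabilityMeasure P]
    (N X : ℕ → Fin p → S → ℝ)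
    (hNlaw : ∀ k i, HasLaw (N k i) (gaussianReal 0 (σ2 i).toNNReal) P)
    (hNindep : iIndepFun (fun ki : ℕ × Fin p => N ki.1 ki.2) P)
    (hX : ∀ k i s, X k i s = ∑ j, B j i * X k j s + N k i s) :
    Tendsto
      (fun n : ℕ => P {s : S | ¬
        ((∃ Ghat : DG p, IsL0Output (Matrix.of fun (k : Fin n) (i : Fin p) => X k i s)
            (0.5 * Real.log n) Ghat) ∧
          ∀ Ghat : DG p, IsL0Output (Matrix.of fun (k : Fin n) (i : Fin p) => X k i s)
            (0.5 * Real.log n) Ghat → Ghat.QuasiEquiv Gstar)})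
      atTop (𝓝 0) := by
  obtain ⟨Gdag, hequiv, -, hmin⟩ := hmin
  have hQQ := hparam.precisionFactor_mul_transpose
  have hdet := DG.eventually_quasiEquiv_of_isL0Output hparam.precisionFactor_det_ne_zero
    (by rw [hQQ]; exact ⟨B, σ2, hparam, rfl⟩) (by rwa [hQQ]) hequiv hmin
  have hprob := tendsto_measure_lt_sqDistOne (Z := fun k i s => N k i s * (√(σ2 i))⁻¹)
    (fun k i => hasLaw_gaussianReal_div_sqrt (hparam.pos i) (hNlaw k i))
    (hNindep.comp (fun ki x => x * (√(σ2 ki.2))⁻¹) fun ki => by fun_prop)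
  refine tendsto_of_tendsto_of_tendsto_of_le_of_le' tendsto_const_nhds hprob
    (Eventually.of_forall fun _ => zero_le) ?_
  filter_upwards [hdet] with n hn
  refine measure_mono fun s hs => ?_
  by_contra hle
  refine hs (hn _ ?_)
  have hmodel : (Matrix.of fun (k : Fin n) (i : Fin p) => X k i s) =
      (Matrix.of fun (k : Fin n) (i : Fin p) => X k i s) * B +
        Matrix.of fun (k : Fin n) (i : Fin p) => N k i s := by
    ext k i
    rw [Matrix.add_apply, Matrix.mul_apply]
    simp only [Matrix.of_apply]
    rw [hX k i s]
    simp only [mul_comm (B _ _)]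
  have hM : (precisionFactor B σ2)ᵀ *
      secondMoment (Matrix.of fun (k : Fin n) (i : Fin p) => X k i s) * precisionFactor B σ2 =
      Matrix.of fun i j => (n : ℝ)⁻¹ * ∑ k ∈ Finset.range n,
        N k i s * (√(σ2 i))⁻¹ * (N k j s * (√(σ2 j))⁻¹) := by
    ext i j
    rw [conj_secondMoment_eq hmodel, Matrix.of_apply, Finset.sum_range]
    simp only [Matrix.of_apply]
  rw [hM]
  exact not_lt.1 hle
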